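/- Let $\alpha\ge 0$, $\gamma>0$, and let $\mu\ge 1$, $\nu\geq 0$ satisfy $\mu+\nu=\alpha-\gamma$ and $\mu\nu=\gamma$ (so $\nu>0$). Let $0\le\xi\le 1$, and let $\lambda$ be a non-negative integrable function on $[0,1]$ with $\int_0^1\lambda(t)\,dt=1$. Put $$\Lambda_\nu(t)=\int_t^1\frac{\lambda(x)}{x^{1/\nu}}\,dx,\qquad \Pi_{\mu,\nu}(t)=\int_t^1\Lambda_\nu(x)\,x^{1/\nu-1-1/\mu}\,dx,$$ and suppose that $\Lambda_\nu$ and $\Pi_{\mu,\nu}$ are integrable on $[0,1]$ and positive on $(0,1)$. Suppose further that $$\frac{\xi\, t^{1/\xi-1/\mu+1}\,\frac{d}{dt}\left(t^{1/\mu-1/\xi}\,\Pi_{\mu,\nu}(t)\right)}{1-t^2}$$ is increasing (not necessarily strictly) on $(0,1)$, where for $\xi=0$ this expression is read as its limit $-\Pi_{\mu,\nu}(t)/(1-t^2)$. Let $g$ and $q$ be the solutions on $[0,1)$, continuous at $0$, of $$\frac{d}{dt}\left(t^{1/\nu}(1+g(t))\right)=\frac{2}{\mu\nu}\,t^{1/\nu-1}\int_0^1\frac{s^{1/\mu-1}}{(1+st)^2}\,ds,\quad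 g(0)=1,$$ $$\frac{d}{dt}\left(t^{1/\nu}q(t)\right)=\frac{1}{\mu\nu}\,t^{1/\nu-1}\int_0^1 s^{1/\mu-1}\frac{1-st}{(1+st)^3}\,ds,\quad q(0)=1,$$ and let $\beta<1$ satisfy $$\frac{\beta}{1-\beta}=-\int_0^1\lambda(t)\left[(1-\xi)g(t)+\xi(2q(t)-1)\right]dt .$$ Let $\mathbb D=\{z\in\mathbb C:|z|<1\}$ and let $\mathcal A$ be the class of analytic functions $f$ in $\mathbb D$ with $f(0)=f'(0)-1=0$. Let $W_\beta(\alpha,\gamma)$ be the class of $f\in\mathcal A$ for which there is $\phi\in\mathbb R$ such that $$\operatorname{Re}\left(e^{i\phi}\left((1-\alpha+2\gamma)\frac{f(z)}{z}+(\alpha-2\gamma)f'(z)+\gamma z f''(z)-\beta\right)\right)>0,\qquad z\in\mathbb D,$$ and let $M(\xi)$ be the class of $f\in\mathcal A$ with $$\operatorname{Re}\frac{\xi z(zf'(z))'+(1-\xi)zf'(z)}{\xi zf'(z)+(1-\xi)f(z)}>0,\qquad z\in\mathbb D$$ (removable singularities at $z=0$ being removed). Then for every $f\in W_\beta(\alpha,\gamma)$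 the function $V_\lambda(f)(z)=\int_0^1\lambda(t)\frac{f(tz)}{t}\,dt$ belongs to $M(\xi)$; that is, $V_\lambda(W_\beta(\alpha,\gamma))\subset M(\xi)$. -/

import Mathlib

open MeasureTheory Set

noncomputable section

/-- The open unit disc in the complex plane. -/
def unitDisc : Set ℂ := Metric.ball 0 1

/-- The class `𝒜` of normalized analytic functions: `f` is analytic in the unit disc and
`f(0) = f'(0) - 1 = 0`. Only the values in the disc matter. -/
def classA : Set (ℂ → ℂ) :=
  {f | DifferentiableOn ℂ f unitDisc ∧ f 0 = 0 ∧ deriv f 0 = 1}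

/-- The class `W_β(α, γ)`. For `f ∈ 𝒜` the number `dslope f 0 z` is `f(z)/z` if `z ≠ 0`, and it is
`f'(0)`, the value of the analytic function `f(z)/z` at its removable singularity, if `z = 0`. -/
def classW (β α γ : ℝ) : Set (ℂ → ℂ) :=
  {f | f ∈ classA ∧ ∃ φ : ℝ, ∀ z ∈ unitDisc,
    0 < (Complex.exp (Complex.I * φ) *
      ((1 - α + 2 * γ) * dslope f 0 z + (α - 2 * γ) * deriv f z
        + γ * z * deriv (deriv f) z - β)).re}

/-- The Pascu class `M(ξ)`: the functions of `𝒜` with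
`Re ((ξ z (z f')' + (1 - ξ) z f') / (ξ z f' + (1 - ξ) f)) > 0` in the unit disc. At `z = 0` the
quotient has a removable singularity with value `1`, so only `z ≠ 0` has to be considered. -/
def classM (ξ : ℝ) : Set (ℂ → ℂ) :=
  {f | f ∈ classA ∧ ∀ z ∈ unitDisc, z ≠ 0 →
    ξ * z * deriv f z + (1 - ξ) * f z ≠ 0 ∧
    0 < ((ξ * z * deriv (fun w => w * deriv f w) z + (1 - ξ) * (z * deriv f z)) /
      (ξ * z * deriv f z + (1 - ξ) * f z)).re}

/-- The integral transform `V_λ(f)(z) = ∫₀¹ λ(t) f(tz)/t dt`. -/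
def Vop (lam : ℝ → ℝ) (f : ℂ → ℂ) (z : ℂ) : ℂ :=
  ∫ t in (0 : ℝ)..1, (lam t : ℂ) * (f (t * z) / t)

/-- `Λ_ν(t) = ∫ₜ¹ λ(x) x^{-1/ν} dx`. -/
def LambdaFn (lam : ℝ → ℝ) (ν t : ℝ) : ℝ :=
  ∫ x in t..1, lam x / x ^ (1 / ν)

/-- `Π_{μ,ν}(t) = ∫ₜ¹ Λ_ν(x) x^{1/ν - 1 - 1/μ} dx` (for `μ > 0`, `ν > 0`). -/
def PiFn (lam : ℝ → ℝ) (μ ν t : ℝ) : ℝ :=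
  ∫ x in t..1, LambdaFn lam ν x * x ^ (1 / ν - 1 - 1 / μ)

/-- `g` solves, on `[0, 1)`, the initial value problem
`d/dt (t^{1/ν} (1 + g(t))) = (2/(μν)) t^{1/ν - 1} ∫₀¹ s^{1/μ - 1} (1 + st)^{-2} ds`, `g(0) = 1`. -/
def IsSolutionG (μ ν : ℝ) (g : ℝ → ℝ) : Prop :=
  g 0 = 1 ∧ ContinuousWithinAt g (Ici 0) 0 ∧
  ∀ t ∈ Ioo (0 : ℝ) 1,
    HasDerivAt (fun x => x ^ (1 / ν) * (1 + g x))
      (2 / (μ * ν) * t ^ (1 / ν - 1) *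
        ∫ s in (0 : ℝ)..1, s ^ (1 / μ - 1) / (1 + s * t) ^ 2) t

/-- `q` solves, on `[0, 1)`, the initial value problem
`d/dt (t^{1/ν} q(t)) = (1/(μν)) t^{1/ν - 1} ∫₀¹ s^{1/μ - 1} (1 - st) (1 + st)^{-3} ds`, `q(0) = 1`.
(The value at `0` of any solution that is continuous at `0` is `1`.) -/
def IsSolutionQ (μ ν : ℝ) (q : ℝ → ℝ) : Prop :=
  q 0 = 1 ∧ ContinuousWithinAt q (Ici 0) 0 ∧
  ∀ t ∈ Ioo (0 : ℝ) 1,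
    HasDerivAt (fun x => x ^ (1 / ν) * q x)
      (1 / (μ * ν) * t ^ (1 / ν - 1) *
        ∫ s in (0 : ℝ)..1, s ^ (1 / μ - 1) * ((1 - s * t) / (1 + s * t) ^ 3)) t

/-- `ξ t^{1/ξ - 1/μ + 1} (d/dt)(t^{1/μ - 1/ξ} Π_{μ,ν}(t)) / (1 - t²)` for `ξ ≠ 0`. The product rule
turns this into `(ξ t Π'_{μ,ν}(t) + (ξ/μ - 1) Π_{μ,ν}(t)) / (1 - t²)`, so that the meaning at
`ξ = 0` (the limit for `ξ → 0`) is `-Π_{μ,ν}(t) / (1 - t²)`. -/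
def pascuQuotient (lam : ℝ → ℝ) (ξ μ ν t : ℝ) : ℝ :=
  if ξ = 0 then -PiFn lam μ ν t / (1 - t ^ 2)
  else ξ * t ^ (1 / ξ - 1 / μ + 1) *
    deriv (fun x => x ^ (1 / μ - 1 / ξ) * PiFn lam μ ν x) t / (1 - t ^ 2)

end

/-! Everything is reduced to a non-vanishing statement about a Hadamard product, which follows from
duality. Write `f(z) = z ∑ bₙ zⁿ` with `b₀ = 1`. The expression defining `W_β(α, γ)` is `k(z) = ∑ kₙ
zⁿ` with `kₙ = (1 + nμ)(1 + nν) bₙ`, and `V_λ f = z ∑ λₙ bₙ zⁿ` with the moments `λₙ = ∫ λ(t) tⁿ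
dt`. Membership in `M(ξ)` says that a quotient `X/Y` has positive real part, which holds if `(1 + ε)
X + (1 - ε) Y ≠ 0` for all `|ε| ≤ 1`. In coefficients this reads `∑ cₙ kₙ zⁿ ≠ 0`, where `cₙ`
(`dualCoeff`) is `(1 + ξn) λₙ / ((1 + nμ)(1 + nν))` times the coefficient `1 + (1 + ε) n / 2` of a
starlike test function divided by its variable.

Duality (`re_hadamard_pos`): integrating the positive function `Re (e^{iφ}(k - β))` on one circle
against `Re (2c - 1 + β/(1 - β))` on another one rules out a zero, provided that `Re (2c(z) - 1 +
β/(1 - β)) > 0` in the disc.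

To prove this last inequality, `Re c(z)` is written as `1/(μν)` times the integral of the test
kernel along the ray `tz` against the weight `W(t) = pascuWeight` (`powerSum_dualCoeff`). The tail
integrals `Λ` and `Π` are adjoint to Hardy means, for which `tⁿ` is an eigenfunction; this produces
the factors in `cₙ`. The equations for `g` and `q` are solved by the same means, and the condition
on `β` becomes `-β/(1 - β) = (2/(μν)) ∫ W(t)/(1 + t)² dt - 1` (`integral_eq_pascuWeight`).

What remains is the extremal inequality `integral_weight_lt_integral_starlike_kernel`: the weighted
kernel integral exceeds `∫ W(t)/(1 + t)² dt`. It rests on a pointwise bound with an error term that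
changes sign at most once, and on the monotonicity of `W(t)/(1 - t²)`. -/

/-! ### Power series in the unit disc -/

/-- The power series with coefficients `a` converges absolutely in the unit disc. -/
def AbsConvOnDisc (a : ℕ → ℂ) : Prop :=
  ∀ r : ℝ, 0 ≤ r → r < 1 → Summable fun n => ‖a n‖ * r ^ n

/-- The sum of the power series with coefficients `a`. -/
noncomputable def powerSum (a : ℕ → ℂ) (z : ℂ) : ℂ := ∑' n, a n * z ^ n

theorem mem_unitDisc {z : ℂ} : z ∈ unitDisc ↔ ‖z‖ < 1 := by
  simp [unitDisc]

namespace AbsConvOnDisc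

variable {a b : ℕ → ℂ}

theorem summable_norm (ha : AbsConvOnDisc a) {z : ℂ} (hz : ‖z‖ < 1) :
    Summable fun n => ‖a n * z ^ n‖ := by
  simpa using ha ‖z‖ (norm_nonneg z) hz

theorem hasSum (ha : AbsConvOnDisc a) {z : ℂ} (hz : ‖z‖ < 1) :
    HasSum (fun n => a n * z ^ n) (powerSum a z) :=
  (ha.summable_norm hz).of_norm.hasSum

theorem add (ha : AbsConvOnDisc a) (hb : AbsConvOnDisc b) :
    AbsConvOnDisc fun n => a n + b n := fun r h0 h1 => by
  refine Summable.of_nonneg_of_le (fun n => by positivity) (fun n => ?_)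
    ((ha r h0 h1).add (hb r h0 h1))
  rw [← add_mul]
  gcongr
  exact norm_add_le _ _

theorem bounded_mul (ha : AbsConvOnDisc a) {m : ℕ → ℂ} {C : ℝ} (hm : ∀ n, ‖m n‖ ≤ C) :
    AbsConvOnDisc fun n => m n * a n := fun r h0 h1 => by
  refine Summable.of_nonneg_of_le (fun n => by positivity) (fun n => ?_)
    ((ha r h0 h1).mul_left C)
  rw [norm_mul, mul_assoc]
  gcongr
  exact hm n

theorem const_mul (ha : AbsConvOnDisc a) (c : ℂ) : AbsConvOnDisc fun n => c * a n :=
  ha.bounded_mul (fun _ => le_rfl)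

theorem mul (ha : AbsConvOnDisc a) (hb : AbsConvOnDisc b) : AbsConvOnDisc fun n => a n * b n :=
  fun r h0 h1 => by
  -- Split the radius as `r = √r · √r`: at radius `√r < 1` one series is summable and the terms of
  -- the other are bounded.
  have hs1 : √r < 1 := by rw [Real.sqrt_lt' one_pos]; simpa using h1
  have hs := ha _ (Real.sqrt_nonneg r) hs1
  obtain ⟨C, hC⟩ := (hb _ (Real.sqrt_nonneg r) hs1).tendsto_atTop_zero.bddAbove_range
  refine Summable.of_nonneg_of_le (fun n => by positivity) (fun n => ?_) (hs.mul_right C)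
  have h : ‖b n‖ * √r ^ n ≤ C := hC ⟨n, rfl⟩
  calc ‖a n * b n‖ * r ^ n = ‖a n‖ * √r ^ n * (‖b n‖ * √r ^ n) := by
        nth_rewrite 1 [← Real.mul_self_sqrt h0]
        rw [norm_mul, mul_pow]; ring
    _ ≤ ‖a n‖ * √r ^ n * C := by gcongr

theorem nat_mul (ha : AbsConvOnDisc a) : AbsConvOnDisc fun n => (n : ℂ) * a n := fun r h0 h1 => by
  obtain ⟨s, hrs, hs1⟩ := exists_between h1
  have hs0 : 0 < s := h0.trans_lt hrs
  have ht := tendsto_self_mul_const_pow_of_lt_one (r := r / s) (by positivity)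
    ((div_lt_one hs0).2 hrs)
  obtain ⟨C, hC⟩ := ht.bddAbove_range
  refine Summable.of_nonneg_of_le (fun n => by positivity) (fun n => ?_)
    ((ha s hs0.le hs1).mul_left C)
  have h := hC ⟨n, rfl⟩
  simp only [div_pow] at h
  rw [mul_div_assoc', div_le_iff₀ (by positivity)] at h
  rw [norm_mul, Complex.norm_natCast]
  calc (n : ℝ) * ‖a n‖ * r ^ n = ‖a n‖ * (n * r ^ n) := by ring
    _ ≤ ‖a n‖ * (C * s ^ n) := by gcongr
    _ = C * (‖a n‖ * s ^ n) := by ring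

theorem shift (ha : AbsConvOnDisc a) : AbsConvOnDisc fun n => a (n + 1) := fun r h0 h1 => by
  obtain ⟨s, hrs, hs1⟩ := exists_between h1
  have hs0 : 0 < s := h0.trans_lt hrs
  refine Summable.of_nonneg_of_le (fun n => by positivity) (fun n => ?_)
    (((summable_nat_add_iff 1).2 (ha s hs0.le hs1)).mul_left s⁻¹)
  calc ‖a (n + 1)‖ * r ^ n ≤ ‖a (n + 1)‖ * s ^ n := by gcongr
    _ = s⁻¹ * (‖a (n + 1)‖ * s ^ (n + 1)) := by
        rw [pow_succ]; field_simp

theorem powerSum_add (ha : AbsConvOnDisc a) (hb : AbsConvOnDisc b) {z : ℂ} (hz : ‖z‖ < 1) :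
    powerSum (fun n => a n + b n) z = powerSum a z + powerSum b z := by
  refine ((ha.add hb).hasSum hz).unique ?_
  simpa only [add_mul] using (ha.hasSum hz).add (hb.hasSum hz)

theorem powerSum_const_mul (ha : AbsConvOnDisc a) (c : ℂ) {z : ℂ} (hz : ‖z‖ < 1) :
    powerSum (fun n => c * a n) z = c * powerSum a z := by
  refine ((ha.const_mul c).hasSum hz).unique ?_
  simpa only [mul_assoc] using (ha.hasSum hz).mul_left c

theorem powerSum_eq_shift (ha : AbsConvOnDisc a) {z : ℂ} (hz : ‖z‖ < 1) :
    powerSum a z = a 0 + z * powerSum (fun n => a (n + 1)) z := by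
  have h : HasSum (fun n => a (n + 1) * z ^ (n + 1)) (z * powerSum (fun n => a (n + 1)) z) := by
    exact ((ha.shift.hasSum hz).mul_left z).congr_fun fun n => by ring
  have h2 := (ha.hasSum hz).summable.tsum_eq_zero_add
  rw [h.tsum_eq] at h2
  simpa [powerSum] using h2

theorem hasDerivAt (ha : AbsConvOnDisc a) {z : ℂ} (hz : ‖z‖ < 1) :
    HasDerivAt (powerSum a) (powerSum (fun n => ((n + 1 : ℕ) : ℂ) * a (n + 1)) z) z := by
  obtain ⟨s, hzs, hs1⟩ := exists_between hz
  have hs0 : 0 ≤ s := (norm_nonneg z).trans hzs.le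
  have hd : AbsConvOnDisc fun n => ((n + 1 : ℕ) : ℂ) * a (n + 1) := ha.nat_mul.shift
  have hu : Summable fun n : ℕ => ‖(n : ℂ) * a n‖ * s ^ (n - 1) := by
    rw [← summable_nat_add_iff 1]
    exact hd s hs0 hs1
  have h := hasDerivAt_tsum_of_isPreconnected hu Metric.isOpen_ball
    (convex_ball (0 : ℂ) s).isPreconnected
    (g := fun (n : ℕ) (w : ℂ) => a n * w ^ n)
    (g' := fun (n : ℕ) (w : ℂ) => a n * ((n : ℂ) * w ^ (n - 1)))
    (fun n w _ => (hasDerivAt_pow n w).const_mul (a n))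
    (fun n w hw => by
      have hw : ‖w‖ < s := by simpa using hw
      rw [norm_mul, norm_mul, norm_mul, norm_pow, ← mul_assoc, mul_comm ‖a n‖]
      gcongr) (y₀ := z) (y := z) (by simpa using hzs) (ha.summable_norm hz).of_norm
    (by simpa using hzs)
  have h2 := hd.hasSum hz
  have h3 : HasSum (fun n => a n * ((n : ℂ) * z ^ (n - 1)))
      (powerSum (fun n => ((n + 1 : ℕ) : ℂ) * a (n + 1)) z) := by
    rw [← hasSum_nat_add_iff' 1]
    simp only [Finset.range_one, Finset.sum_singleton, Nat.cast_zero, zero_mul, mul_zero, sub_zero]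
    exact h2.congr_fun fun n => by simp; ring
  rw [h3.tsum_eq] at h
  exact h

end AbsConvOnDisc

theorem exists_powerSum_eq {f : ℂ → ℂ} (hf : DifferentiableOn ℂ f unitDisc) :
    ∃ a : ℕ → ℂ, AbsConvOnDisc a ∧ ∀ z, ‖z‖ < 1 → f z = powerSum a z := by
  have key : ∀ z : ℂ, ‖z‖ < 1 →
      HasSum (fun n : ℕ => ((n.factorial : ℂ)⁻¹ * iteratedDeriv n f 0) * z ^ n) (f z) := by
    intro z hz
    have h := Complex.hasSum_taylorSeries_on_ball hf (c := 0) (r := 1) (z := z) (by simpa using hz)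
    exact h.congr_fun fun n => by simp; ring
  have hac : AbsConvOnDisc fun n : ℕ => (n.factorial : ℂ)⁻¹ * iteratedDeriv n f 0 := by
    intro r h0 h1
    have h := (key (r : ℂ) (by simpa [abs_of_nonneg h0] using h1)).summable.norm
    simpa [abs_of_nonneg h0] using h
  exact ⟨_, hac, fun z hz => (key z hz).unique (hac.hasSum hz)⟩

/-! ### Circle means and duality for Hadamard products -/

theorem integral_exp_int_mul (j : ℤ) :
    ∫ θ in (0 : ℝ)..(2 * Real.pi), Complex.exp (j * Complex.I * θ)
      = if j = 0 then (2 * Real.pi : ℂ) else 0 := by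
  split_ifs with h
  · simp [h]
  · have hc : (j : ℂ) * Complex.I ≠ 0 := by simp [h]
    rw [integral_exp_mul_complex hc]
    have : (j : ℂ) * Complex.I * ((2 * Real.pi : ℝ) : ℂ) = j * (2 * Real.pi * Complex.I) := by
      push_cast; ring
    rw [this, Complex.exp_int_mul_two_pi_mul_I]
    simp

namespace AbsConvOnDisc

variable {c k : ℕ → ℂ}

theorem continuous_comp (hc : AbsConvOnDisc c) {v : ℝ → ℂ} (hv : Continuous v)
    (h1 : ∀ θ, ‖v θ‖ < 1) : Continuous fun θ => powerSum c (v θ) :=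
  continuous_iff_continuousAt.2 fun θ =>
    ContinuousAt.comp (f := v) (hc.hasDerivAt (h1 θ)).continuousAt hv.continuousAt

theorem hasSum_integral (hc : AbsConvOnDisc c) {G u : ℝ → ℂ} (hG : Continuous G)
    (hu : Continuous u) (hu1 : ∀ θ, ‖u θ‖ = 1) {b : ℂ} (hb : ‖b‖ < 1) (x y : ℝ) :
    HasSum (fun n => c n * b ^ n * ∫ θ in x..y, G θ * u θ ^ n)
      (∫ θ in x..y, G θ * powerSum c (b * u θ)) := by
  have hs : Summable fun n => ‖c n * b ^ n‖ := hc.summable_norm hb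
  have h := intervalIntegral.hasSum_integral_of_dominated_convergence (μ := volume)
    (a := x) (b := y) (F := fun n θ => c n * b ^ n * (G θ * u θ ^ n))
    (f := fun θ => G θ * powerSum c (b * u θ)) (fun n θ => ‖c n * b ^ n‖ * ‖G θ‖)
    (fun n => Continuous.aestronglyMeasurable (by fun_prop))
    (fun n => Filter.Eventually.of_forall fun θ _ => by simp [hu1])
    (Filter.Eventually.of_forall fun θ _ => hs.mul_right _)
    (by
      simp_rw [tsum_mul_right]
      exact Continuous.intervalIntegrable (by fun_prop) _ _)
    (Filter.Eventually.of_forall fun θ _ => by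
      have h := (hc.hasSum (z := b * u θ) (by simpa [hu1] using hb)).mul_left (G θ)
      exact h.congr_fun fun n => by rw [mul_pow]; ring)
  simpa only [intervalIntegral.integral_const_mul] using h

/-- Orthogonality of the exponentials on the circle isolates one coefficient; the companion with
positive exponents sees only the constant term. -/
theorem integral_powerSum_circle_mul (hk : AbsConvOnDisc k) {a : ℂ} (ha : ‖a‖ < 1) (m : ℕ) :
    ∫ θ in (0 : ℝ)..(2 * Real.pi), Complex.exp (-(θ * Complex.I)) ^ m *
      powerSum k (a * Complex.exp (θ * Complex.I)) = 2 * Real.pi * (k m * a ^ m) := by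
  have h := hk.hasSum_integral (G := fun θ : ℝ => Complex.exp (-(θ * Complex.I)) ^ m)
    (u := fun θ : ℝ => Complex.exp (θ * Complex.I)) (by fun_prop) (by fun_prop)
    (fun θ => Complex.norm_exp_ofReal_mul_I θ) ha 0 (2 * Real.pi)
  refine h.unique ?_
  have e : ∀ n : ℕ, (∫ θ in (0 : ℝ)..(2 * Real.pi), Complex.exp (-(θ * Complex.I)) ^ m *
      Complex.exp (θ * Complex.I) ^ n) = if n = m then (2 * Real.pi : ℂ) else 0 := by
    intro n
    have h := integral_exp_int_mul ((n : ℤ) - m)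
    simp only [sub_eq_zero, Nat.cast_inj] at h
    rw [← h]
    congr 1
    ext θ
    rw [← Complex.exp_nat_mul, ← Complex.exp_nat_mul, ← Complex.exp_add]
    congr 1
    push_cast
    ring
  simp_rw [e]
  have := hasSum_ite_eq m (2 * Real.pi * (k m * a ^ m) : ℂ)
  refine this.congr_fun fun n => ?_
  split_ifs with hn
  · subst hn; ring
  · simp

theorem integral_powerSum_circle_mul_pos (hk : AbsConvOnDisc k) {a : ℂ} (ha : ‖a‖ < 1) (m : ℕ) :
    ∫ θ in (0 : ℝ)..(2 * Real.pi), Complex.exp (θ * Complex.I) ^ m *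
      powerSum k (a * Complex.exp (θ * Complex.I)) = if m = 0 then 2 * Real.pi * k 0 else 0 := by
  have h := hk.hasSum_integral (G := fun θ : ℝ => Complex.exp (θ * Complex.I) ^ m)
    (u := fun θ : ℝ => Complex.exp (θ * Complex.I)) (by fun_prop) (by fun_prop)
    (fun θ => Complex.norm_exp_ofReal_mul_I θ) ha 0 (2 * Real.pi)
  refine h.unique ?_
  have e : ∀ n : ℕ, (∫ θ in (0 : ℝ)..(2 * Real.pi), Complex.exp (θ * Complex.I) ^ m *
      Complex.exp (θ * Complex.I) ^ n) = if n = 0 ∧ m = 0 then (2 * Real.pi : ℂ) else 0 := by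
    intro n
    have h := integral_exp_int_mul ((n : ℤ) + m)
    have h2 : ((n : ℤ) + m = 0) ↔ (n = 0 ∧ m = 0) := by omega
    simp only [h2] at h
    rw [← h]
    congr 1
    ext θ
    rw [← Complex.exp_nat_mul, ← Complex.exp_nat_mul, ← Complex.exp_add]
    congr 1
    push_cast
    ring
  simp_rw [e]
  have := hasSum_ite_eq 0 (if m = 0 then (2 * Real.pi * k 0 : ℂ) else 0)
  refine this.congr_fun fun n => ?_
  by_cases hn : n = 0 <;> by_cases hm : m = 0 <;> simp [hn, hm]
  ring

/-- The mean over the circle of `2 Re K` times a power series with coefficients `c`. -/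
theorem integral_re_mul_powerSum (hk : AbsConvOnDisc k) (hc : AbsConvOnDisc c) {a b : ℂ}
    (ha : ‖a‖ < 1) (hb : ‖b‖ < 1) :
    ∫ θ in (0 : ℝ)..(2 * Real.pi),
      ((2 * (powerSum k (a * Complex.exp (θ * Complex.I))).re : ℝ) : ℂ) *
        powerSum c (b * Complex.exp (-(θ * Complex.I)))
      = 2 * Real.pi * (powerSum (fun n => c n * k n) (a * b) + c 0 * star (k 0)) := by
  have hcont : Continuous fun θ : ℝ => powerSum k (a * Complex.exp (θ * Complex.I)) :=
    hk.continuous_comp (by fun_prop) fun θ => by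
      simpa [Complex.norm_exp_ofReal_mul_I] using ha
  have hnorm : ∀ θ : ℝ, ‖Complex.exp (-(θ * Complex.I))‖ = 1 := fun θ => by
    have := Complex.norm_exp_ofReal_mul_I (-θ)
    simpa using this
  have h := hc.hasSum_integral
    (G := fun θ : ℝ => ((2 * (powerSum k (a * Complex.exp (θ * Complex.I))).re : ℝ) : ℂ))
    (u := fun θ : ℝ => Complex.exp (-(θ * Complex.I)))
    (by fun_prop) (by fun_prop) hnorm hb 0 (2 * Real.pi)
  refine h.unique ?_
  -- Since `2 Re K = K + conj K`, the part `K` contributes its coefficient of index `m`, and `conj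
  -- K` has only nonpositive frequencies, so it contributes for `m = 0` alone.
  have e : ∀ m : ℕ, (∫ θ in (0 : ℝ)..(2 * Real.pi),
      ((2 * (powerSum k (a * Complex.exp (θ * Complex.I))).re : ℝ) : ℂ) *
        Complex.exp (-(θ * Complex.I)) ^ m)
      = 2 * Real.pi * (k m * a ^ m) + (if m = 0 then 2 * Real.pi * star (k 0) else 0) := by
    intro m
    have h1 := hk.integral_powerSum_circle_mul ha m
    have h2 := congrArg (starRingEnd ℂ) (hk.integral_powerSum_circle_mul_pos ha m)
    rw [intervalIntegral.integral_of_le Real.two_pi_pos.le, ← integral_conj,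
      ← intervalIntegral.integral_of_le Real.two_pi_pos.le] at h2
    have h3 : (if m = 0 then 2 * Real.pi * star (k 0) else 0 : ℂ) =
        (starRingEnd ℂ) (if m = 0 then 2 * Real.pi * k 0 else 0) := by
      split_ifs
      · rw [map_mul, map_mul, Complex.conj_ofReal, map_ofNat]; rfl
      · simp
    rw [h3, ← h1, ← h2, ← intervalIntegral.integral_add]
    · congr 1
      ext θ
      have h4 : (starRingEnd ℂ) (Complex.exp (θ * Complex.I)) = Complex.exp (-(θ * Complex.I)) := by
        rw [← Complex.exp_conj]
        simp
      rw [map_mul, map_pow, h4, ← Complex.add_conj]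
      ring
    · exact Continuous.intervalIntegrable (by fun_prop) _ _
    · exact Continuous.intervalIntegrable
        (Complex.continuous_conj.comp (by fun_prop :
          Continuous fun θ : ℝ => Complex.exp (θ * Complex.I) ^ m *
            powerSum k (a * Complex.exp (θ * Complex.I)))) _ _
  simp_rw [e]
  have hab : ‖a * b‖ < 1 := by
    rw [norm_mul]
    exact mul_lt_one_of_nonneg_of_lt_one_left (norm_nonneg _) ha hb.le
  have hck : Summable fun n => c n * k n * (a * b) ^ n :=
    ((hc.mul hk).hasSum hab).summable
  have h6 := (hck.hasSum.add (hasSum_ite_eq 0 (c 0 * star (k 0)))).mul_left (2 * Real.pi : ℂ)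
  refine h6.congr_fun fun n => ?_
  rw [mul_pow]
  by_cases hn : n = 0
  · simp [hn]; ring
  · simp [hn]; ring

/-- Duality: a Hadamard product with a function of sufficiently large real part maps the
functions whose values lie in a half plane to functions with values in a half plane. -/
theorem re_hadamard_pos (hk : AbsConvOnDisc k) (hc : AbsConvOnDisc c) {δ : ℝ}
    (hK : ∀ z, ‖z‖ < 1 → 0 < (powerSum k z).re)
    (hU : ∀ z, ‖z‖ < 1 → 0 < (2 * powerSum c z - 1 + δ).re) (hc0 : c 0 = 1)
    {z : ℂ} (hz : ‖z‖ < 1) :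
    0 < (powerSum (fun n => c n * k n) z + (star (k 0)) + (δ - 1) * (k 0).re).re := by
  obtain ⟨a, b, ha, hb, rfl⟩ : ∃ a b : ℂ, ‖a‖ < 1 ∧ ‖b‖ < 1 ∧ a * b = z := by
    by_cases h0 : z = 0
    · exact ⟨0, 0, by simp, by simp, by simp [h0]⟩
    have hz0 : 0 < ‖z‖ := norm_pos_iff.2 h0
    have hs0 : 0 < √‖z‖ := Real.sqrt_pos.2 hz0
    have hs1 : √‖z‖ < 1 := by rw [Real.sqrt_lt' one_pos]; simpa using hz
    refine ⟨(√‖z‖ : ℝ), z / (√‖z‖ : ℝ), ?_, ?_, ?_⟩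
    · rw [Complex.norm_real, Real.norm_of_nonneg hs0.le]; exact hs1
    · rw [norm_div, Complex.norm_real, Real.norm_of_nonneg hs0.le, Real.div_sqrt]; exact hs1
    · exact mul_div_cancel₀ z (Complex.ofReal_ne_zero.2 hs0.ne')
  have hnorm : ∀ θ : ℝ, ‖Complex.exp (-(θ * Complex.I))‖ = 1 := fun θ => by
    have := Complex.norm_exp_ofReal_mul_I (-θ)
    simpa using this
  have ha' : ∀ θ : ℝ, ‖a * Complex.exp (θ * Complex.I)‖ < 1 := fun θ => by
    simpa [Complex.norm_exp_ofReal_mul_I] using ha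
  have hb' : ∀ θ : ℝ, ‖b * Complex.exp (-(θ * Complex.I))‖ < 1 := fun θ => by
    simpa [hnorm] using hb
  have hcont : Continuous fun θ : ℝ => powerSum k (a * Complex.exp (θ * Complex.I)) :=
    hk.continuous_comp (by fun_prop) ha'
  have hcontc : Continuous fun θ : ℝ => powerSum c (b * Complex.exp (-(θ * Complex.I))) :=
    hc.continuous_comp (by fun_prop) hb'
  have h1 := hk.integral_re_mul_powerSum hc ha hb
  have h2 := hk.integral_powerSum_circle_mul_pos ha 0
  simp only [pow_zero, one_mul, if_true] at h2
  have h1r := congrArg Complex.re h1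
  have h2r := congrArg Complex.re h2
  have reint : ∀ F : ℝ → ℂ, Continuous F →
      (∫ θ in (0 : ℝ)..(2 * Real.pi), F θ).re = ∫ θ in (0 : ℝ)..(2 * Real.pi), (F θ).re :=
    fun F hF => (Complex.reCLM.intervalIntegral_comp_comm
      (hF.intervalIntegrable _ _)).symm
  rw [reint _ (by fun_prop)] at h1r h2r
  -- The mean of a product of two positive functions, taken at `a e^{iθ}` and `b e^{-iθ}`; expanding
  -- it leaves a series in `ab = z`, and the claim appears multiplied by `2π`.
  have hpos : 0 < ∫ θ in (0 : ℝ)..(2 * Real.pi),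
      (powerSum k (a * Complex.exp (θ * Complex.I))).re *
        (2 * powerSum c (b * Complex.exp (-(θ * Complex.I))) - 1 + δ).re := by
    refine intervalIntegral.intervalIntegral_pos_of_pos
      (Continuous.intervalIntegrable (by fun_prop) _ _) (fun θ => ?_) Real.two_pi_pos
    exact mul_pos (hK _ (ha' θ)) (hU _ (hb' θ))
  have hsplit : (∫ θ in (0 : ℝ)..(2 * Real.pi),
      (powerSum k (a * Complex.exp (θ * Complex.I))).re *
        (2 * powerSum c (b * Complex.exp (-(θ * Complex.I))) - 1 + δ).re)
      = (∫ θ in (0 : ℝ)..(2 * Real.pi),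
        (((2 * (powerSum k (a * Complex.exp (θ * Complex.I))).re : ℝ) : ℂ) *
        powerSum c (b * Complex.exp (-(θ * Complex.I)))).re) +
        (δ - 1) * ∫ θ in (0 : ℝ)..(2 * Real.pi),
          (powerSum k (a * Complex.exp (θ * Complex.I))).re := by
    rw [← intervalIntegral.integral_const_mul, ← intervalIntegral.integral_add]
    · congr 1
      ext θ
      simp
      ring
    · exact Continuous.intervalIntegrable (by fun_prop) _ _
    · exact Continuous.intervalIntegrable (by fun_prop) _ _
  rw [hsplit, h1r, h2r, hc0] at hpos
  have e : (2 * Real.pi * (powerSum (fun n => c n * k n) (a * b) + 1 * star (k 0)) : ℂ).re +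
      (δ - 1) * (2 * Real.pi * k 0 : ℂ).re = 2 * Real.pi *
      (powerSum (fun n => c n * k n) (a * b) + (star (k 0)) + (δ - 1) * (k 0).re).re := by
    simp
    ring
  rw [e] at hpos
  exact (mul_pos_iff_of_pos_left Real.two_pi_pos).1 hpos

end AbsConvOnDisc

/-! ### The extremal inequality for starlike kernels -/

theorem one_sub_two_mul_add_sq_pos {r x : ℝ} (h0 : 0 ≤ r) (h1 : r < 1) (hx : x ≤ 1) :
    0 < 1 - 2 * r * x + r ^ 2 := by
  nlinarith [mul_nonneg h0 (sub_nonneg.2 hx), pow_pos (sub_pos.2 h1) 2]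

/-- The cubic polynomial governing the sign of the derivative of
`r² (1 - r)² / (1 - 2 r x + r²)`. -/
def signCubic (x r : ℝ) : ℝ := 1 - 2 * r - r ^ 3 + x * (3 * r ^ 2 - r)

theorem signCubic_antitone {x r s : ℝ} (hx0 : -1 ≤ x) (hx1 : x ≤ 1) (h0 : 0 ≤ r) (hrs : r ≤ s) :
    signCubic x s ≤ signCubic x r := by
  -- This is the difference quotient of `signCubic` with the sign reversed. It is affine in `x`, so
  -- only `x = 1` or `x = -1` matters, depending on the sign of `3(s + r) - 1`.
  have h : 0 ≤ 2 + (s ^ 2 + s * r + r ^ 2) - x * (3 * (s + r) - 1) := by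
    have hs : 0 ≤ s := h0.trans hrs
    rcases le_total 0 (3 * (s + r) - 1) with h | h
    · have : 0 ≤ (1 - x) * (3 * (s + r) - 1) := mul_nonneg (by linarith) h
      nlinarith [sq_nonneg ((1 - s) + (1 - r)), sq_nonneg (1 - s), sq_nonneg (1 - r)]
    · have : (1 + x) * (3 * (s + r) - 1) ≤ 0 := mul_nonpos_of_nonneg_of_nonpos (by linarith) h
      nlinarith [mul_nonneg hs h0, sq_nonneg s, sq_nonneg r]
  have := mul_nonneg (sub_nonneg.2 hrs) h
  unfold signCubic
  linarith

/-- Half the derivative of `r² (1 - r)² / (1 - 2 r x + r²)`. -/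
noncomputable def halfDerivKernel (x r : ℝ) : ℝ :=
  r * (1 - r) * signCubic x r / (1 - 2 * r * x + r ^ 2) ^ 2

theorem hasDerivAt_kernel {x r : ℝ} (hD : 0 < 1 - 2 * r * x + r ^ 2) :
    HasDerivAt (fun r : ℝ => r ^ 2 * (1 - r) ^ 2 / (1 - 2 * r * x + r ^ 2))
      (2 * halfDerivKernel x r) r := by
  have h1 : HasDerivAt (fun r : ℝ => r ^ 2 * (1 - r) ^ 2)
      (2 * r * (1 - r) ^ 2 + r ^ 2 * (2 * (1 - r) * (-1))) r := by
    have ha := (hasDerivAt_id r).pow 2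
    have hb := ((hasDerivAt_id r).const_sub 1).pow 2
    exact (ha.mul hb).congr_deriv (by simp)
  have h2 : HasDerivAt (fun r : ℝ => 1 - 2 * r * x + r ^ 2) (-(2 * x) + 2 * r) r := by
    have ha := (hasDerivAt_id r).pow 2
    have hb := (((hasDerivAt_id r).const_mul 2).mul_const x).const_sub 1
    exact (hb.add ha).congr_deriv (by simp)
  refine (h1.div h2 hD.ne').congr_deriv ?_
  unfold halfDerivKernel signCubic
  rw [mul_div_assoc']
  congr 1
  ring

theorem continuousOn_halfDerivKernel {x ρ : ℝ} (hx1 : x ≤ 1) (h0 : 0 ≤ ρ) (h1 : ρ < 1) :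
    ContinuousOn (fun t => halfDerivKernel x (ρ * t)) (Icc 0 1) := by
  have hD : ∀ t ∈ Icc (0 : ℝ) 1, (1 - 2 * (ρ * t) * x + (ρ * t) ^ 2) ^ 2 ≠ 0 := fun t ht =>
    (pow_pos (one_sub_two_mul_add_sq_pos (mul_nonneg h0 ht.1)
      ((mul_le_of_le_one_right h0 ht.2).trans_lt h1) hx1) 2).ne'
  unfold halfDerivKernel signCubic
  exact ContinuousOn.div (by fun_prop) (by fun_prop) hD

theorem integrableOn_mul_of_continuousOn {v k : ℝ → ℝ} (hv : IntegrableOn v (Ioo 0 1))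
    (hk : ContinuousOn k (Icc 0 1)) : IntegrableOn (fun t => v t * k t) (Ioo 0 1) := by
  rw [← integrableOn_Icc_iff_integrableOn_Ioo] at hv ⊢
  exact hv.mul_continuousOn hk isCompact_Icc

/-- A Chebyshev-type argument: the kernel changes sign at most once, from plus to minus, and a
decreasing weight favours the positive part. The unweighted integral is nonnegative because the
kernel has an explicit primitive that vanishes at `0` and is nonnegative afterwards. -/
theorem integral_antitone_mul_kernel_nonneg {v : ℝ → ℝ} {x ρ : ℝ}
    (hv : IntegrableOn v (Ioo 0 1)) (hv0 : ∀ t ∈ Ioo (0 : ℝ) 1, 0 ≤ v t)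
    (hanti : AntitoneOn v (Ioo 0 1)) (hx0 : -1 ≤ x) (hx1 : x ≤ 1) (h0 : 0 ≤ ρ) (h1 : ρ < 1) :
    0 ≤ ∫ t in Ioo (0 : ℝ) 1, v t * halfDerivKernel x (ρ * t) := by
  have hkc := continuousOn_halfDerivKernel hx1 h0 h1
  have hr : ∀ t ∈ Icc (0 : ℝ) 1, 0 ≤ ρ * t ∧ ρ * t < 1 := fun t ht =>
    ⟨mul_nonneg h0 ht.1, (mul_le_of_le_one_right h0 ht.2).trans_lt h1⟩
  have hfac : ∀ t ∈ Icc (0 : ℝ) 1, 0 ≤ ρ * t * (1 - ρ * t) / (1 - 2 * (ρ * t) * x + (ρ * t) ^ 2) ^ 2 :=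
    fun t ht => div_nonneg (mul_nonneg (hr t ht).1 (by linarith [(hr t ht).2])) (sq_nonneg _)
  have hk : ∀ t, halfDerivKernel x (ρ * t) =
      ρ * t * (1 - ρ * t) / (1 - 2 * (ρ * t) * x + (ρ * t) ^ 2) ^ 2 * signCubic x (ρ * t) :=
    fun t => by unfold halfDerivKernel; ring
  by_cases hn : 0 ≤ signCubic x ρ
  · refine setIntegral_nonneg measurableSet_Ioo fun t ht => mul_nonneg (hv0 t ht) ?_
    have ht' := Ioo_subset_Icc_self ht
    rw [hk]
    refine mul_nonneg (hfac t ht') (hn.trans ?_)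
    exact signCubic_antitone hx0 hx1 (hr t ht').1 (mul_le_of_le_one_right h0 ht'.2)
  · push Not at hn
    have hρ : 0 < ρ := by
      rcases h0.eq_or_lt with h | h
      · rw [← h] at hn; norm_num [signCubic] at hn
      · exact h
    have hcont : ContinuousOn (fun t => signCubic x (ρ * t)) (Icc 0 1) := by
      unfold signCubic; fun_prop
    obtain ⟨t₀, ht₀, hz⟩ : (0 : ℝ) ∈ (fun t => signCubic x (ρ * t)) '' Icc 0 1 := by
      refine intermediate_value_Icc' zero_le_one hcont ⟨?_, ?_⟩
      · simpa using hn.le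
      · norm_num [signCubic]
    have hz : signCubic x (ρ * t₀) = 0 := hz
    have ht₀' : t₀ ∈ Ioo (0 : ℝ) 1 := by
      refine ⟨lt_of_le_of_ne ht₀.1 ?_, lt_of_le_of_ne ht₀.2 ?_⟩
      · rintro rfl; norm_num [signCubic] at hz
      · rintro rfl; rw [mul_one] at hz; exact hn.ne hz
    -- Freezing the weight at the sign change `t₀` lowers the integrand on both sides of it.
    have hlow : ∀ t ∈ Ioo (0 : ℝ) 1,
        v t₀ * halfDerivKernel x (ρ * t) ≤ v t * halfDerivKernel x (ρ * t) := by
      intro t ht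
      have ht' := Ioo_subset_Icc_self ht
      have hf := hfac t ht'
      rw [hk t, ← sub_nonneg]
      rcases le_total t t₀ with h | h
      · have ha := hanti ht ht₀' h
        have hs : 0 ≤ signCubic x (ρ * t) := by
          rw [← hz]
          exact signCubic_antitone hx0 hx1 (hr t ht').1 (by gcongr)
        have := mul_nonneg (sub_nonneg.2 ha) (mul_nonneg hf hs)
        linarith
      · have ha := hanti ht₀' ht h
        have hs : signCubic x (ρ * t) ≤ 0 := by
          rw [← hz]
          exact signCubic_antitone hx0 hx1 (hr t₀ ht₀).1 (by gcongr)
        have := mul_nonneg (sub_nonneg.2 ha) (mul_nonneg hf (neg_nonneg.2 hs))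
        linarith
    have hkint : IntegrableOn (fun t => halfDerivKernel x (ρ * t)) (Ioo 0 1) :=
      (hkc.integrableOn_Icc).mono_set Ioo_subset_Icc_self
    refine le_trans ?_ (setIntegral_mono_on (hkint.const_mul (v t₀))
      (integrableOn_mul_of_continuousOn hv hkc) measurableSet_Ioo hlow)
    rw [integral_const_mul]
    refine mul_nonneg (hv0 t₀ ht₀') ?_
    rw [← integral_Ioc_eq_integral_Ioo, ← intervalIntegral.integral_of_le zero_le_one]
    have hderiv : ∀ t ∈ uIcc (0 : ℝ) 1, HasDerivAt
        (fun t : ℝ => (2 * ρ)⁻¹ * ((ρ * t) ^ 2 * (1 - ρ * t) ^ 2 /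
          (1 - 2 * (ρ * t) * x + (ρ * t) ^ 2))) (halfDerivKernel x (ρ * t)) t := by
      intro t ht
      rw [uIcc_of_le zero_le_one] at ht
      have h := hasDerivAt_kernel
        (one_sub_two_mul_add_sq_pos (hr t ht).1 (hr t ht).2 hx1)
      have h3 : HasDerivAt (fun t : ℝ => ρ * t) ρ t := by
        simpa using (hasDerivAt_id t).const_mul ρ
      refine ((HasDerivAt.comp (h₂ := fun r : ℝ => r ^ 2 * (1 - r) ^ 2 / (1 - 2 * r * x + r ^ 2))
        t h h3).const_mul (2 * ρ)⁻¹).congr_deriv ?_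
      field_simp
    rw [intervalIntegral.integral_eq_sub_of_hasDerivAt hderiv
      (ContinuousOn.intervalIntegrable (by rwa [uIcc_of_le zero_le_one]))]
    have := one_sub_two_mul_add_sq_pos h0 h1 hx1
    simp only [mul_one, mul_zero]
    norm_num
    positivity

/-- A lower bound on the circle `|w| = r` that does not depend on `ε`. -/
theorem le_re_starlike_kernel {w ε : ℂ} {r x : ℝ} (hw : ‖w‖ = r) (hr1 : r < 1)
    (hre : w.re = r * x) (hx1 : x ≤ 1) (hx0 : -1 ≤ x) (hε : ‖ε‖ ≤ 1) :
    1 / (1 + r) ^ 2 + (1 + x) * ((1 - r ^ 2)⁻¹ * halfDerivKernel x r) ≤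
      ((1 + (ε - 1) / 2 * w) / (1 - w) ^ 2).re := by
  have h0 : 0 ≤ r := hw ▸ norm_nonneg w
  have hD := one_sub_two_mul_add_sq_pos h0 hr1 hx1
  set D := 1 - 2 * r * x + r ^ 2 with hDdef
  have hsq : w.re ^ 2 + w.im ^ 2 = r ^ 2 := by
    rw [← hw, Complex.sq_norm, Complex.normSq_apply]; ring
  have hnsq : Complex.normSq (1 - w) = D := by
    rw [Complex.normSq_apply]
    simp only [Complex.sub_re, Complex.one_re, Complex.sub_im, Complex.one_im]
    rw [hDdef]
    nlinarith
  have hne : 1 - w ≠ 0 := fun h => by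
    rw [h, map_zero] at hnsq; exact hD.ne hnsq
  -- Only the last of the three terms contains `ε`; it is bounded by its modulus, the other two are
  -- computed exactly.
  have hsplit : (1 + (ε - 1) / 2 * w) / (1 - w) ^ 2 =
      (1 - w)⁻¹ / 2 + ((1 - w) ^ 2)⁻¹ / 2 + ε * w / (1 - w) ^ 2 / 2 := by
    field_simp
    ring
  have e1 : ((1 - w)⁻¹).re = (1 - r * x) / D := by
    rw [Complex.inv_re, hnsq]; simp [hre]
  have e2 : (((1 - w) ^ 2)⁻¹).re = (1 - 2 * r * x + 2 * r ^ 2 * x ^ 2 - r ^ 2) / D ^ 2 := by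
    rw [Complex.inv_re, map_pow, hnsq]
    congr 1
    rw [hre] at hsq
    simp only [pow_two, Complex.mul_re, Complex.sub_re, Complex.one_re, Complex.sub_im,
      Complex.one_im, hre]
    nlinarith
  have e3 : -(r / D) ≤ (ε * w / (1 - w) ^ 2).re := by
    have h := (abs_le.1 (Complex.abs_re_le_norm (ε * w / (1 - w) ^ 2))).1
    refine le_trans (neg_le_neg ?_) h
    rw [norm_div, norm_pow, Complex.sq_norm, hnsq, norm_mul, hw]
    gcongr
    exact mul_le_of_le_one_left h0 hε
  have hsplit' := congrArg Complex.re hsplit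
  have half : ∀ c : ℂ, (c / 2).re = c.re / 2 := fun c => by
    rw [← Complex.ofReal_ofNat, Complex.div_ofReal_re]
  rw [Complex.add_re, Complex.add_re, half, half, half, e1, e2] at hsplit'
  rw [hsplit']
  -- The remaining slack is an explicit nonnegative fraction, which vanishes at `x = -1`, the
  -- direction of the extremal point.
  have key : (1 - r * x) / D / 2 + (1 - 2 * r * x + 2 * r ^ 2 * x ^ 2 - r ^ 2) / D ^ 2 / 2
      - r / D / 2 - 1 / (1 + r) ^ 2 - (1 + x) * ((1 - r ^ 2)⁻¹ * halfDerivKernel x r)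
      = (1 + x) * r * (1 - r) ^ 2 / (2 * (1 + r) ^ 2 * D) := by
    have h1r : 1 - r ≠ 0 := by linarith
    have h2r : 1 + r ≠ 0 := by linarith
    have h3r : 1 - r ^ 2 = (1 - r) * (1 + r) := by ring
    unfold halfDerivKernel signCubic
    rw [h3r, ← hDdef]
    field_simp
    rw [hDdef]
    ring
  have hnn : 0 ≤ (1 + x) * r * (1 - r) ^ 2 / (2 * (1 + r) ^ 2 * D) := by
    have : 0 ≤ 1 + x := by linarith
    positivity
  linarith

theorem exists_re_eq_norm_mul (z : ℂ) : ∃ x : ℝ, -1 ≤ x ∧ x ≤ 1 ∧ z.re = ‖z‖ * x := by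
  by_cases h : z = 0
  · exact ⟨0, by norm_num, by norm_num, by simp [h]⟩
  · have h0 := norm_pos_iff.2 h
    have h1 := abs_le.1 (Complex.abs_re_le_norm z)
    refine ⟨z.re / ‖z‖, ?_, ?_, by field_simp⟩
    · rw [le_div_iff₀ h0]; linarith [h1.1]
    · rw [div_le_one h0]; exact h1.2

/-- The extremal inequality: if `W(t) / (1 - t²)` is decreasing, the weighted mean of
`Re (h(tz)/(tz))` over the starlike test functions `h` is minimal for the Koebe function at
`z = -1`. -/
theorem integral_weight_lt_integral_starlike_kernel {W : ℝ → ℝ} (hW : IntegrableOn W (Ioo 0 1))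
    (hWpos : ∀ t ∈ Ioo (0 : ℝ) 1, 0 < W t)
    (hanti : AntitoneOn (fun t => W t / (1 - t ^ 2)) (Ioo 0 1)) {z ε : ℂ} (hz : ‖z‖ < 1)
    (hε : ‖ε‖ ≤ 1) :
    ∫ t in Ioo (0 : ℝ) 1, W t * (1 / (1 + t) ^ 2) <
      ∫ t in Ioo (0 : ℝ) 1, W t * ((1 + (ε - 1) / 2 * (t * z)) / (1 - t * z) ^ 2).re := by
  obtain ⟨x, hx0, hx1, hre⟩ := exists_re_eq_norm_mul z
  set ρ := ‖z‖ with hρ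
  have h0 : 0 ≤ ρ := norm_nonneg z
  have hr : ∀ t ∈ Icc (0 : ℝ) 1, 0 ≤ ρ * t ∧ ρ * t < 1 := fun t ht =>
    ⟨mul_nonneg h0 ht.1, (mul_le_of_le_one_right h0 ht.2).trans_lt hz⟩
  have hsqpos : ∀ t ∈ Icc (0 : ℝ) 1, 0 < 1 - (ρ * t) ^ 2 := fun t ht => by
    nlinarith [hr t ht]
  -- The factor `(1 - r²)⁻¹` in the pointwise bound, at `r = ρt`, is absorbed into the weight.
  set v : ℝ → ℝ := fun t => W t * (1 - (ρ * t) ^ 2)⁻¹ with hv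
  have hvint : IntegrableOn v (Ioo 0 1) :=
    integrableOn_mul_of_continuousOn hW
      (ContinuousOn.inv₀ (by fun_prop) fun t ht => (hsqpos t ht).ne')
  have hv0 : ∀ t ∈ Ioo (0 : ℝ) 1, 0 ≤ v t := fun t ht =>
    mul_nonneg (hWpos t ht).le (inv_nonneg.2 (hsqpos t (Ioo_subset_Icc_self ht)).le)
  -- `v` is the product of `W(t)/(1 - t²)` and `(1 - t²)/(1 - ρ²t²)`; both are nonnegative and
  -- decreasing, the second because `ρ ≤ 1`.
  have hvanti : AntitoneOn v (Ioo 0 1) := by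
    intro s hs t ht hst
    have hs1 : 0 < 1 - s ^ 2 := by nlinarith [hs.1, hs.2]
    have ht1 : 0 < 1 - t ^ 2 := by nlinarith [ht.1, ht.2]
    have hs2 := hsqpos s (Ioo_subset_Icc_self hs)
    have ht2 := hsqpos t (Ioo_subset_Icc_self ht)
    have e : ∀ u, 0 < 1 - u ^ 2 →
        v u = W u / (1 - u ^ 2) * ((1 - u ^ 2) / (1 - (ρ * u) ^ 2)) := fun u hu => by
      rw [hv]; field_simp
    rw [e s hs1, e t ht1]
    refine mul_le_mul (hanti hs ht hst) ?_ (div_nonneg ht1.le ht2.le)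
      (div_nonneg (hWpos s hs).le hs1.le)
    rw [div_le_div_iff₀ ht2 hs2]
    have h3 : s ^ 2 ≤ t ^ 2 := pow_le_pow_left₀ hs.1.le hst 2
    have h4 : ρ ^ 2 ≤ 1 := by nlinarith
    nlinarith [mul_nonneg (sub_nonneg.2 h3) (sub_nonneg.2 h4)]
  have hker := integral_antitone_mul_kernel_nonneg hvint hv0 hvanti hx0 hx1 h0 hz
  have hkc := continuousOn_halfDerivKernel hx1 h0 hz
  have hc1 : ContinuousOn (fun t : ℝ => 1 / (1 + ρ * t) ^ 2) (Icc 0 1) :=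
    ContinuousOn.div (by fun_prop) (by fun_prop) fun t ht => by
      have := (hr t ht).1; positivity
  have hc2 : ContinuousOn (fun t : ℝ => 1 / (1 + t) ^ 2) (Icc 0 1) :=
    ContinuousOn.div (by fun_prop) (by fun_prop) fun t ht => by
      have := ht.1; positivity
  have hnorm : ∀ t ∈ Icc (0 : ℝ) 1, ‖(t : ℂ) * z‖ = ρ * t := fun t ht => by
    rw [norm_mul, Complex.norm_real, Real.norm_of_nonneg ht.1, mul_comm]
  have hc3 : ContinuousOn
      (fun t : ℝ => ((1 + (ε - 1) / 2 * (t * z)) / (1 - t * z) ^ 2).re) (Icc 0 1) := by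
    refine Complex.continuous_re.comp_continuousOn
      (ContinuousOn.div (by fun_prop) (by fun_prop) fun t ht => ?_)
    refine pow_ne_zero 2 (sub_ne_zero.2 fun h => ?_)
    have := hnorm t ht
    rw [← h, norm_one] at this
    exact (hr t ht).2.ne this.symm
  have step : ∫ t in Ioo (0 : ℝ) 1, (W t * (1 / (1 + ρ * t) ^ 2) +
      (1 + x) * (v t * halfDerivKernel x (ρ * t))) ≤
      ∫ t in Ioo (0 : ℝ) 1, W t * ((1 + (ε - 1) / 2 * (t * z)) / (1 - t * z) ^ 2).re := by
    refine setIntegral_mono_on ((integrableOn_mul_of_continuousOn hW hc1).add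
      ((integrableOn_mul_of_continuousOn hvint hkc).const_mul _))
      (integrableOn_mul_of_continuousOn hW hc3) measurableSet_Ioo fun t ht => ?_
    have ht' := Ioo_subset_Icc_self ht
    have h := le_re_starlike_kernel (hnorm t ht') (hr t ht').2 (x := x)
      (by rw [Complex.re_ofReal_mul, hre]; ring) hx1 hx0 hε
    have := mul_le_mul_of_nonneg_left h (hWpos t ht).le
    refine le_trans (le_of_eq ?_) this
    rw [hv]
    ring
  rw [integral_add (integrableOn_mul_of_continuousOn hW hc1)
    ((integrableOn_mul_of_continuousOn hvint hkc).const_mul _), integral_const_mul] at step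
  -- Strictness comes from `ρ < 1` and the positivity of `W`.
  have hstrict : ∫ t in Ioo (0 : ℝ) 1, W t * (1 / (1 + t) ^ 2) <
      ∫ t in Ioo (0 : ℝ) 1, W t * (1 / (1 + ρ * t) ^ 2) := by
    rw [← sub_pos, ← integral_sub (integrableOn_mul_of_continuousOn hW hc1)
      (integrableOn_mul_of_continuousOn hW hc2),
      ← integral_Ioc_eq_integral_Ioo, ← intervalIntegral.integral_of_le zero_le_one]
    refine intervalIntegral.intervalIntegral_pos_of_pos_on ?_ (fun t ht => ?_) one_pos
    · rw [intervalIntegrable_iff_integrableOn_Ioo_of_le zero_le_one]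
      exact (integrableOn_mul_of_continuousOn hW hc1).sub (integrableOn_mul_of_continuousOn hW hc2)
    · rw [← mul_sub]
      refine mul_pos (hWpos t ht) (sub_pos.2 ?_)
      have h3 := (hr t (Ioo_subset_Icc_self ht)).1
      refine one_div_lt_one_div_of_lt (by positivity) ?_
      have h5 : ρ * t < t := by nlinarith [ht.1]
      gcongr
  have := mul_nonneg (by linarith : 0 ≤ 1 + x) hker
  linarith

/-! ### Hardy means and tail integrals -/

/-- Bounded continuous functions on the open unit interval. -/
def BddContOnUnit (ψ : ℝ → ℝ) : Prop :=
  ContinuousOn ψ (Ioo 0 1) ∧ ∃ C, 0 ≤ C ∧ ∀ t ∈ Ioo (0 : ℝ) 1, |ψ t| ≤ C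

/-- The weighted Hardy mean `x^{-a} ∫₀ˣ t^{a-1} ψ(t) dt`. -/
noncomputable def hardyMean (a : ℝ) (ψ : ℝ → ℝ) (x : ℝ) : ℝ :=
  x ^ (-a) * ∫ t in (0 : ℝ)..x, t ^ (a - 1) * ψ t

theorem integrableOn_rpow_sub_one {a : ℝ} (ha : 0 < a) :
    IntegrableOn (fun t : ℝ => t ^ (a - 1)) (Ioo 0 1) := by
  rw [← intervalIntegrable_iff_integrableOn_Ioo_of_le zero_le_one]
  exact intervalIntegral.intervalIntegrable_rpow' (by linarith)

namespace BddContOnUnit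

variable {ψ χ : ℝ → ℝ}

theorem of_continuousOn_Icc (h : ContinuousOn ψ (Icc 0 1)) : BddContOnUnit ψ := by
  obtain ⟨C, hC⟩ := isCompact_Icc.exists_bound_of_continuousOn h
  refine ⟨h.mono Ioo_subset_Icc_self, |C|, abs_nonneg C, fun t ht => ?_⟩
  exact (hC t (Ioo_subset_Icc_self ht)).trans (le_abs_self C)

theorem abs (h : BddContOnUnit ψ) : BddContOnUnit fun t => |ψ t| := by
  obtain ⟨hc, C, h0, hC⟩ := h
  exact ⟨hc.abs, C, h0, fun t ht => by simpa using hC t ht⟩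

theorem const_mul (h : BddContOnUnit ψ) (c : ℝ) : BddContOnUnit fun t => c * ψ t := by
  obtain ⟨hc, C, h0, hC⟩ := h
  refine ⟨continuousOn_const.mul hc, |c| * C, by positivity, fun t ht => ?_⟩
  rw [abs_mul]
  exact mul_le_mul_of_nonneg_left (hC t ht) (abs_nonneg c)

theorem add (h : BddContOnUnit ψ) (h' : BddContOnUnit χ) : BddContOnUnit fun t => ψ t + χ t := by
  obtain ⟨hc, C, h0, hC⟩ := h
  obtain ⟨hc', C', h0', hC'⟩ := h'
  exact ⟨hc.add hc', C + C', by positivity, fun t ht =>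
    (abs_add_le _ _).trans (add_le_add (hC t ht) (hC' t ht))⟩

theorem integrableOn_mul (h : BddContOnUnit ψ) {κ : ℝ → ℝ} (hκ : IntegrableOn κ (Ioo 0 1)) :
    IntegrableOn (fun t => κ t * ψ t) (Ioo 0 1) := by
  obtain ⟨hc, C, h0, hC⟩ := h
  exact Integrable.mul_bdd (c := C) hκ (hc.aestronglyMeasurable measurableSet_Ioo)
    ((ae_restrict_iff' measurableSet_Ioo).2 (Filter.Eventually.of_forall hC))

theorem intervalIntegrable (h : BddContOnUnit ψ) {a x : ℝ} (ha : 0 < a) (hx0 : 0 ≤ x)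
    (hx1 : x ≤ 1) : IntervalIntegrable (fun t => t ^ (a - 1) * ψ t) volume 0 x := by
  rw [intervalIntegrable_iff_integrableOn_Ioo_of_le hx0]
  exact (h.integrableOn_mul (integrableOn_rpow_sub_one ha)).mono_set
    (Ioo_subset_Ioo_right hx1)

theorem hasDerivAt_primitive (h : BddContOnUnit ψ) {a x : ℝ} (ha : 0 < a)
    (hx : x ∈ Ioo (0 : ℝ) 1) :
    HasDerivAt (fun x => ∫ t in (0 : ℝ)..x, t ^ (a - 1) * ψ t) (x ^ (a - 1) * ψ x) x := by
  have hc : ContinuousOn (fun t : ℝ => t ^ (a - 1) * ψ t) (Ioo 0 1) :=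
    ContinuousOn.mul (fun t ht =>
      (Real.continuousAt_rpow_const t _ (Or.inl ht.1.ne')).continuousWithinAt) h.1
  exact intervalIntegral.integral_hasDerivAt_right (h.intervalIntegrable ha hx.1.le hx.2.le)
    (hc.stronglyMeasurableAtFilter isOpen_Ioo x hx)
    (hc.continuousAt (isOpen_Ioo.mem_nhds hx))

/-- A bound `C` becomes `C / a`, since `∫₀ˣ t^{a-1} dt = x^a / a`. This stability permits iterating
the means. -/
theorem hardyMean (h : BddContOnUnit ψ) {a : ℝ} (ha : 0 < a) :
    BddContOnUnit (hardyMean a ψ) := by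
  refine ⟨fun x hx => ?_, ?_⟩
  · exact ((Real.continuousAt_rpow_const x _ (Or.inl hx.1.ne')).mul
      (h.hasDerivAt_primitive ha hx).continuousAt).continuousWithinAt
  · obtain ⟨hc, C, h0, hC⟩ := h
    refine ⟨C / a, by positivity, fun x hx => ?_⟩
    have hb : ‖∫ t in (0 : ℝ)..x, t ^ (a - 1) * ψ t‖ ≤ ∫ t in (0 : ℝ)..x, C * t ^ (a - 1) := by
      refine intervalIntegral.norm_integral_le_of_norm_le hx.1.le ?_ ?_
      · refine Filter.Eventually.of_forall fun t ht => ?_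
        have htr : 0 ≤ t ^ (a - 1) := Real.rpow_nonneg ht.1.le _
        rw [norm_mul, Real.norm_of_nonneg htr, mul_comm]
        exact mul_le_mul_of_nonneg_right (hC t ⟨ht.1, ht.2.trans_lt hx.2⟩) htr
      · exact (intervalIntegral.intervalIntegrable_rpow' (by linarith)).const_mul C
    rw [intervalIntegral.integral_const_mul, integral_rpow (Or.inl (by linarith)),
      sub_add_cancel, Real.zero_rpow ha.ne', sub_zero] at hb
    have hxa : 0 < x ^ a := Real.rpow_pos_of_pos hx.1 a
    unfold _root_.hardyMean
    rw [abs_mul, Real.rpow_neg hx.1.le, abs_of_pos (inv_pos.2 hxa)]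
    calc (x ^ a)⁻¹ * |∫ t in (0 : ℝ)..x, t ^ (a - 1) * ψ t|
        ≤ (x ^ a)⁻¹ * (C * (x ^ a / a)) := by gcongr; exact hb
      _ = C / a := by field_simp

theorem setIntegral_indicator_Iio {a x : ℝ} (hx : x ∈ Ioo (0 : ℝ) 1) (φ : ℝ → ℝ) :
    ∫ t in Ioo (0 : ℝ) 1, (Iio x).indicator (fun t => t ^ (a - 1) * φ t) t
      = x ^ a * _root_.hardyMean a φ x := by
  rw [setIntegral_indicator measurableSet_Iio]
  have : Ioo (0 : ℝ) 1 ∩ Iio x = Ioo 0 x := by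
    ext t; constructor
    · exact fun h => ⟨h.1.1, h.2⟩
    · exact fun h => ⟨⟨h.1, h.2.trans hx.2⟩, h.2⟩
  rw [this, ← integral_Ioc_eq_integral_Ioo, ← intervalIntegral.integral_of_le hx.1.le]
  unfold _root_.hardyMean
  rw [← mul_assoc, ← Real.rpow_add hx.1]
  simp

/-- Integration by parts against an iterated tail integral, in the form of Fubini's theorem. -/
theorem integral_tail_mul (h : BddContOnUnit ψ) {κ : ℝ → ℝ} (hκ : IntegrableOn κ (Ioo 0 1))
    {a : ℝ} (ha : 0 < a) :
    IntegrableOn (fun t => t ^ (a - 1) * (∫ x in t..1, κ x * x ^ (-a)) * ψ t) (Ioo 0 1) ∧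
    ∫ t in Ioo (0 : ℝ) 1, t ^ (a - 1) * (∫ x in t..1, κ x * x ^ (-a)) * ψ t
      = ∫ x in Ioo (0 : ℝ) 1, κ x * _root_.hardyMean a ψ x := by
  set m : Measure ℝ := volume.restrict (Ioo 0 1) with hm
  set S : Set (ℝ × ℝ) := {p | p.1 < p.2} with hS
  have hSm : MeasurableSet S := measurableSet_lt measurable_fst measurable_snd
  set K : ℝ × ℝ → ℝ := S.indicator fun p => (p.1 ^ (a - 1) * ψ p.1) * (κ p.2 * p.2 ^ (-a)) with hK
  have hmeas1 : AEStronglyMeasurable (fun t : ℝ => t ^ (a - 1) * ψ t) m :=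
    (h.integrableOn_mul (integrableOn_rpow_sub_one ha)).aestronglyMeasurable
  have hmeas2 : AEStronglyMeasurable (fun x : ℝ => κ x * x ^ (-a)) m :=
    hκ.aestronglyMeasurable.mul
      (measurable_id.pow_const (-a)).aestronglyMeasurable
  have hKm : AEStronglyMeasurable K (m.prod m) :=
    (hmeas1.comp_fst.mul hmeas2.comp_snd).indicator hSm
  have hslice : ∀ x t, K (t, x) =
      (Iio x).indicator (fun t => t ^ (a - 1) * ψ t) t * (κ x * x ^ (-a)) := fun x t => by
    by_cases hlt : t < x <;> simp [hK, hS, hlt]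
  have hslice' : ∀ x t, ‖K (t, x)‖ =
      (Iio x).indicator (fun t => |t ^ (a - 1)| * |ψ t|) t * |κ x * x ^ (-a)| := fun x t => by
    by_cases hlt : t < x <;> simp [hK, hS, hlt, abs_mul]
  have hcancel : ∀ x ∈ Ioo (0 : ℝ) 1, x ^ a * x ^ (-a) = 1 := fun x hx => by
    rw [← Real.rpow_add hx.1]; simp
  have hint1 : ∀ x ∈ Ioo (0 : ℝ) 1, ∫ t, K (t, x) ∂m = κ x * _root_.hardyMean a ψ x := by
    intro x hx
    simp_rw [hslice]
    rw [integral_mul_const, hm, setIntegral_indicator_Iio hx]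
    linear_combination (κ x * _root_.hardyMean a ψ x) * hcancel x hx
  have hint2 : ∀ x ∈ Ioo (0 : ℝ) 1,
      ∫ t, ‖K (t, x)‖ ∂m = |κ x| * _root_.hardyMean a (fun t => |ψ t|) x := by
    intro x hx
    simp_rw [hslice']
    rw [integral_mul_const, hm]
    have e : ∫ t in Ioo (0 : ℝ) 1, (Iio x).indicator (fun t => |t ^ (a - 1)| * |ψ t|) t
        = ∫ t in Ioo (0 : ℝ) 1, (Iio x).indicator (fun t => t ^ (a - 1) * |ψ t|) t := by
      refine setIntegral_congr_fun measurableSet_Ioo fun t ht => ?_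
      simp only [abs_of_nonneg (Real.rpow_nonneg ht.1.le (a - 1)), indicator]
    rw [e, setIntegral_indicator_Iio hx, abs_mul, abs_of_nonneg (Real.rpow_nonneg hx.1.le (-a))]
    linear_combination (|κ x| * _root_.hardyMean a (fun t => |ψ t|) x) * hcancel x hx
  -- Integrating over `t` first turns the norm of the triangle kernel into `|κ|` times a Hardy mean
  -- of `|ψ|`, which is bounded; no bound on the tail integral is needed.
  have hKint : Integrable K (m.prod m) := by
    rw [integrable_prod_iff' hKm]
    constructor
    · refine Filter.Eventually.of_forall fun x => ?_
      simp_rw [hslice]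
      exact ((h.integrableOn_mul (integrableOn_rpow_sub_one ha)).indicator
        measurableSet_Iio).mul_const _
    · refine IntegrableOn.congr_fun ((h.abs.hardyMean ha).integrableOn_mul hκ.abs)
        (fun x hx => (hint2 x hx).symm) measurableSet_Ioo
  have hint3 : ∀ t ∈ Ioo (0 : ℝ) 1, ∫ x, K (t, x) ∂m =
      t ^ (a - 1) * (∫ x in t..1, κ x * x ^ (-a)) * ψ t := by
    intro t ht
    have e : ∀ x, K (t, x) =
        (Ioi t).indicator (fun x => (t ^ (a - 1) * ψ t) * (κ x * x ^ (-a))) x := fun x => by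
      by_cases hlt : t < x <;> simp [hK, hS, hlt]
    simp_rw [e]
    rw [hm, setIntegral_indicator measurableSet_Ioi]
    have : Ioo (0 : ℝ) 1 ∩ Ioi t = Ioo t 1 := by
      ext x; constructor
      · exact fun h => ⟨h.2, h.1.2⟩
      · exact fun h => ⟨⟨ht.1.trans h.1, h.2⟩, h.1⟩
    rw [this, integral_const_mul, ← integral_Ioc_eq_integral_Ioo,
      ← intervalIntegral.integral_of_le ht.2.le]
    ring
  constructor
  · exact IntegrableOn.congr_fun (s := Ioo 0 1) hKint.integral_prod_left
      (fun t ht => hint3 t ht) measurableSet_Ioo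
  · rw [← setIntegral_congr_fun measurableSet_Ioo hint3,
      ← setIntegral_congr_fun measurableSet_Ioo hint1]
    exact integral_integral_swap (f := fun t x => K (t, x)) hKint

/-- Solutions of `(x^b y)' = x^{b-1} χ` which are continuous at `0` are Hardy means. -/
theorem eq_hardyMean_of_hasDerivAt (h : BddContOnUnit χ) {b : ℝ} (hb : 0 < b) {y : ℝ → ℝ}
    (hy0 : ContinuousWithinAt y (Ici 0) 0)
    (hy : ∀ t ∈ Ioo (0 : ℝ) 1, HasDerivAt (fun x => x ^ b * y x) (t ^ (b - 1) * χ t) t)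
    {t : ℝ} (ht : t ∈ Ioo (0 : ℝ) 1) : y t = _root_.hardyMean b χ t := by
  have hD : ∀ x ∈ Ioo (0 : ℝ) 1, HasDerivAt
      (fun x => x ^ b * y x - ∫ t in (0 : ℝ)..x, t ^ (b - 1) * χ t) 0 x := fun x hx => by
    exact ((hy x hx).sub (h.hasDerivAt_primitive hb hx)).congr_deriv (sub_self _)
  have hprim : ∀ x ∈ Ioo (0 : ℝ) 1, ∫ t in (0 : ℝ)..x, t ^ (b - 1) * χ t
      = x ^ b * _root_.hardyMean b χ x := fun x hx => by
    unfold _root_.hardyMean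
    rw [← mul_assoc, ← Real.rpow_add hx.1]
    simp
  -- The difference of the two solutions times `x^b` is constant. Both solutions are bounded near
  -- `0` and `x^b → 0`, so the constant is `0`.
  have hconst : ∀ x ∈ Ioo (0 : ℝ) 1, x ^ b * (y x - _root_.hardyMean b χ x) =
      t ^ b * (y t - _root_.hardyMean b χ t) := fun x hx => by
    have := isOpen_Ioo.is_const_of_deriv_eq_zero (isPreconnected_Ioo)
      (fun z hz => (hD z hz).differentiableAt.differentiableWithinAt)
      (fun z hz => (hD z hz).deriv) hx ht
    simp only [hprim x hx, hprim t ht] at this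
    linarith
  obtain ⟨-, C, hC0, hC⟩ := h.hardyMean hb
  have hev : ∀ᶠ x in nhdsWithin (0 : ℝ) (Ioi 0), x ∈ Ioo (0 : ℝ) 1 :=
    Ioo_mem_nhdsGT one_pos
  have hy1 : Filter.Tendsto y (nhdsWithin 0 (Ioi 0)) (nhds (y 0)) :=
    hy0.mono_left (nhdsWithin_mono 0 Ioi_subset_Ici_self)
  have hyb : ∀ᶠ x in nhdsWithin (0 : ℝ) (Ioi 0), |y x| ≤ |y 0| + 1 :=
    (hy1.abs.eventually_lt_const (lt_add_one _)).mono fun x hx => hx.le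
  have hpow : Filter.Tendsto (fun x : ℝ => x ^ b) (nhdsWithin 0 (Ioi 0)) (nhds 0) := by
    have := (Real.continuousAt_rpow_const 0 b (Or.inr hb.le)).tendsto
    rw [Real.zero_rpow hb.ne'] at this
    exact this.mono_left nhdsWithin_le_nhds
  have hlim : Filter.Tendsto (fun x : ℝ => x ^ b * (|y 0| + 1 + C)) (nhdsWithin 0 (Ioi 0))
      (nhds 0) := by simpa using hpow.mul_const (|y 0| + 1 + C)
  have hle : |t ^ b * (y t - _root_.hardyMean b χ t)| ≤ 0 := by
    refine ge_of_tendsto hlim ?_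
    filter_upwards [hev, hyb] with x hx hxb
    rw [← hconst x hx, abs_mul, abs_of_nonneg (Real.rpow_nonneg hx.1.le b)]
    refine mul_le_mul_of_nonneg_left ?_ (Real.rpow_nonneg hx.1.le b)
    exact (abs_sub _ _).trans (add_le_add hxb (hC x hx))
  have hzero := abs_eq_zero.1 (le_antisymm hle (abs_nonneg _))
  have := (mul_eq_zero.1 hzero).resolve_left (Real.rpow_pos_of_pos ht.1 b).ne'
  linarith

end BddContOnUnit

/-- Powers are eigenfunctions with eigenvalue `1/(a + n)`; for `a = 1/μ` and `a = 1/ν` this is the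
source of the factors `1 + nμ` and `1 + nν`. -/
theorem hardyMean_pow {a : ℝ} (ha : 0 < a) (n : ℕ) {x : ℝ} (hx : 0 < x) :
    hardyMean a (fun t => t ^ n) x = x ^ n / (a + n) := by
  have e : ∫ t in (0 : ℝ)..x, t ^ (a - 1) * t ^ n = ∫ t in (0 : ℝ)..x, t ^ (a - 1 + n) := by
    refine intervalIntegral.integral_congr_ae (Filter.Eventually.of_forall fun t ht => ?_)
    rw [uIoc_of_le hx.le] at ht
    rw [Real.rpow_add_natCast ht.1.ne']
  have hn : (0 : ℝ) ≤ n := n.cast_nonneg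
  have h0 : a + n ≠ 0 := by positivity
  unfold hardyMean
  rw [e, integral_rpow (Or.inl (by linarith)), show a - 1 + n + 1 = a + n by ring,
    Real.zero_rpow h0, sub_zero, ← mul_div_assoc, ← Real.rpow_add hx,
    show -a + (a + n) = (n : ℝ) by ring, Real.rpow_natCast]

theorem hardyMean_const_mul (a c : ℝ) (ψ : ℝ → ℝ) (x : ℝ) :
    hardyMean a (fun t => c * ψ t) x = c * hardyMean a ψ x := by
  unfold hardyMean
  simp_rw [mul_left_comm _ c]
  rw [intervalIntegral.integral_const_mul]
  ring

theorem hardyMean_add {a : ℝ} (ha : 0 < a) {ψ χ : ℝ → ℝ} (h : BddContOnUnit ψ)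
    (h' : BddContOnUnit χ) {x : ℝ} (hx : x ∈ Ioo (0 : ℝ) 1) :
    hardyMean a (fun t => ψ t + χ t) x = hardyMean a ψ x + hardyMean a χ x := by
  unfold hardyMean
  simp_rw [mul_add]
  rw [intervalIntegral.integral_add (h.intervalIntegrable ha hx.1.le hx.2.le)
    (h'.intervalIntegrable ha hx.1.le hx.2.le)]
  ring

theorem hardyMean_congr {a : ℝ} {ψ χ : ℝ → ℝ} (h : ∀ t ∈ Ioo (0 : ℝ) 1, ψ t = χ t) {x : ℝ}
    (hx : x ∈ Ioo (0 : ℝ) 1) : hardyMean a ψ x = hardyMean a χ x := by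
  unfold hardyMean
  congr 1
  refine intervalIntegral.integral_congr_ae (Filter.Eventually.of_forall fun t ht => ?_)
  rw [uIoc_of_le hx.1.le] at ht
  rw [h t ⟨ht.1, ht.2.trans_lt hx.2⟩]

/-- The substitution `v = st`; it puts the right-hand sides of the equations for `g` and `q` into
Hardy form. -/
theorem integral_scaled_eq_hardyMean {a t : ℝ} (ht : 0 < t) (ψ : ℝ → ℝ) :
    ∫ s in (0 : ℝ)..1, s ^ (a - 1) * ψ (s * t) = hardyMean a ψ t := by
  have h := intervalIntegral.integral_comp_mul_right (a := 0) (b := 1)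
    (fun v => v ^ (a - 1) * ψ v) ht.ne'
  rw [zero_mul, one_mul] at h
  have e : ∫ s in (0 : ℝ)..1, (s * t) ^ (a - 1) * ψ (s * t) =
      ∫ s in (0 : ℝ)..1, t ^ (a - 1) * (s ^ (a - 1) * ψ (s * t)) := by
    refine intervalIntegral.integral_congr fun s hs => ?_
    rw [uIcc_of_le zero_le_one] at hs
    simp only [Real.mul_rpow hs.1 ht.le]
    ring
  rw [e, intervalIntegral.integral_const_mul, smul_eq_mul] at h
  have h1 : t ^ (a - 1) = t ^ a * t⁻¹ := by rw [Real.rpow_sub_one ht.ne']; ring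
  have h2 : t ^ (-a) = (t ^ a)⁻¹ := Real.rpow_neg ht.le a
  have hta : t ^ a ≠ 0 := (Real.rpow_pos_of_pos ht a).ne'
  unfold hardyMean
  rw [h2, eq_inv_mul_iff_mul_eq₀ hta]
  rw [h1] at h
  refine mul_left_cancel₀ (inv_ne_zero ht.ne') ?_
  linear_combination h

/-- The Hardy mean of `(t ψ)'` for `ψ(t) = (1 + t)⁻²`. -/
theorem hardyMean_deriv_kernel {a x : ℝ} (ha : 0 < a) (hx : x ∈ Ioo (0 : ℝ) 1) :
    hardyMean a (fun t => (1 - t) / (1 + t) ^ 3) x =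
      1 / (1 + x) ^ 2 + (1 - a) * hardyMean a (fun t => 1 / (1 + t) ^ 2) x := by
  have c2 : BddContOnUnit fun t : ℝ => 1 / (1 + t) ^ 2 := .of_continuousOn_Icc <|
    ContinuousOn.div (by fun_prop) (by fun_prop) fun t ht => by have := ht.1; positivity
  have c3 : BddContOnUnit fun t : ℝ => (1 - t) / (1 + t) ^ 3 := .of_continuousOn_Icc <|
    ContinuousOn.div (by fun_prop) (by fun_prop) fun t ht => by have := ht.1; positivity
  have i2 := c2.intervalIntegrable ha hx.1.le hx.2.le
  have i3 := c3.intervalIntegrable ha hx.1.le hx.2.le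
  -- The primitive is `t^a / (1 + t)²`.
  have ftc : ∫ t in (0 : ℝ)..x, (t ^ (a - 1) * ((1 - t) / (1 + t) ^ 3) -
      (1 - a) * (t ^ (a - 1) * (1 / (1 + t) ^ 2))) =
      x ^ a * (1 / (1 + x) ^ 2) - 0 ^ a * (1 / (1 + 0) ^ 2) := by
    refine intervalIntegral.integral_eq_sub_of_hasDerivAt_of_le
      (f := fun t : ℝ => t ^ a * (1 / (1 + t) ^ 2)) hx.1.le ?_ (fun t ht => ?_)
      (i3.sub (i2.const_mul (1 - a)))
    · refine ContinuousOn.mul (fun t _ =>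
        (Real.continuousAt_rpow_const t a (Or.inr ha.le)).continuousWithinAt) ?_
      exact ContinuousOn.div (by fun_prop) (by fun_prop) fun t ht => by
        have := ht.1; positivity
    · have ht1 : 1 + t ≠ 0 := by linarith [ht.1]
      have h1 := Real.hasDerivAt_rpow_const (x := t) (p := a) (Or.inl ht.1.ne')
      have h2 : HasDerivAt (fun t : ℝ => 1 / (1 + t) ^ 2) (-2 / (1 + t) ^ 3) t := by
        have h3 := (((hasDerivAt_id t).const_add 1).pow 2).fun_inv (pow_ne_zero 2 ht1)
        simp only [one_div]
        refine h3.congr_deriv ?_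
        simp only [Pi.pow_apply, id]
        field_simp
        push_cast
        ring
      refine (h1.mul h2).congr_deriv ?_
      have e : t ^ a = t ^ (a - 1) * t := by
        rw [Real.rpow_sub_one ht.1.ne']; field_simp [ht.1.ne']
      rw [e]
      field_simp
      ring
  rw [intervalIntegral.integral_sub i3 (i2.const_mul (1 - a)),
    intervalIntegral.integral_const_mul, Real.zero_rpow ha.ne'] at ftc
  unfold hardyMean
  have hxa : x ^ (-a) * x ^ a = 1 := by rw [← Real.rpow_add hx.1]; simp
  linear_combination x ^ (-a) * ftc + (1 / (1 + x) ^ 2) * hxa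

/-! ### The weight built from `Λ` and `Π` -/

section Weight

variable {lam : ℝ → ℝ} {μ ν ξ : ℝ}

theorem LambdaFn_eq {t : ℝ} (ht : t ∈ Ioo (0 : ℝ) 1) :
    LambdaFn lam ν t = ∫ x in t..1, lam x * x ^ (-(1 / ν)) := by
  refine intervalIntegral.integral_congr fun x hx => ?_
  rw [uIcc_of_le ht.2.le] at hx
  simp only [Real.rpow_neg (ht.1.le.trans hx.1), div_eq_mul_inv]

/-- Regrouping the powers shows `Π` as a tail integral of the form required by `integral_tail_mul`,
with a density that contains the tail integral `Λ`. -/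
theorem PiFn_eq {t : ℝ} (ht : t ∈ Ioo (0 : ℝ) 1) :
    PiFn lam μ ν t = ∫ x in t..1, (x ^ (1 / ν - 1) * LambdaFn lam ν x) * x ^ (-(1 / μ)) := by
  refine intervalIntegral.integral_congr fun x hx => ?_
  rw [uIcc_of_le ht.2.le] at hx
  simp only [sub_eq_add_neg _ (1 / μ), Real.rpow_add (ht.1.trans_le hx.1)]
  ring

theorem continuousOn_LambdaFn (hlam : IntegrableOn lam (Icc 0 1)) {t : ℝ} (ht : 0 < t)
    (ht1 : t ≤ 1) : ContinuousOn (LambdaFn lam ν) (Icc t 1) := by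
  rw [← uIcc_of_le ht1]
  refine intervalIntegral.continuousOn_primitive_interval_left ?_
  rw [uIcc_of_le ht1]
  simp only [div_eq_mul_inv]
  refine IntegrableOn.mul_continuousOn (hlam.mono_set (Icc_subset_Icc_left ht.le)) ?_ isCompact_Icc
  exact ContinuousOn.inv₀ (fun x hx =>
    (Real.continuousAt_rpow_const x _ (Or.inl (ht.trans_le hx.1).ne')).continuousWithinAt)
    fun x hx => (Real.rpow_pos_of_pos (ht.trans_le hx.1) _).ne'

theorem hasDerivAt_PiFn (hlam : IntegrableOn lam (Icc 0 1)) {t : ℝ} (ht : t ∈ Ioo (0 : ℝ) 1) :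
    HasDerivAt (PiFn lam μ ν) (-(LambdaFn lam ν t * t ^ (1 / ν - 1 - 1 / μ))) t := by
  have hc : ∀ s, 0 < s → s ≤ 1 →
      ContinuousOn (fun x => LambdaFn lam ν x * x ^ (1 / ν - 1 - 1 / μ)) (Icc s 1) :=
    fun s hs hs1 => (continuousOn_LambdaFn hlam hs hs1).mul fun x hx =>
      (Real.continuousAt_rpow_const x _ (Or.inl (hs.trans_le hx.1).ne')).continuousWithinAt
  have hc2 := hc (t / 2) (by linarith [ht.1]) (by linarith [ht.1, ht.2])
  have hc3 : ContinuousOn (fun x => LambdaFn lam ν x * x ^ (1 / ν - 1 - 1 / μ)) (Ioo (t / 2) 1) :=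
    hc2.mono Ioo_subset_Icc_self
  have hmem : t ∈ Ioo (t / 2) 1 := ⟨by linarith [ht.1], ht.2⟩
  refine intervalIntegral.integral_hasDerivAt_left ?_
    (hc3.stronglyMeasurableAtFilter isOpen_Ioo t hmem)
    (hc3.continuousAt (isOpen_Ioo.mem_nhds hmem))
  refine ContinuousOn.intervalIntegrable ?_
  rw [uIcc_of_le ht.2.le]
  exact hc t ht.1 ht.2.le

/-- The weight `t^{1/μ-1} ((1 - ξ/μ) Π(t) - ξ t Π'(t))`. -/
noncomputable def pascuWeight (lam : ℝ → ℝ) (ξ μ ν t : ℝ) : ℝ :=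
  (1 - ξ / μ) * (t ^ (1 / μ - 1) * PiFn lam μ ν t) + ξ * (t ^ (1 / ν - 1) * LambdaFn lam ν t)

/-- The product rule cancels the powers involving `1/ξ`, which leaves one formula that also covers
the convention at `ξ = 0`. -/
theorem pascuQuotient_eq (hlam : IntegrableOn lam (Icc 0 1)) {t : ℝ} (ht : t ∈ Ioo (0 : ℝ) 1) :
    pascuQuotient lam ξ μ ν t =
      -((1 - ξ / μ) * PiFn lam μ ν t + ξ * (t ^ (1 / ν - 1 / μ) * LambdaFn lam ν t)) /
        (1 - t ^ 2) := by
  unfold pascuQuotient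
  split_ifs with h
  · simp [h]
  · congr 1
    have h1 := (Real.hasDerivAt_rpow_const (x := t) (p := 1 / μ - 1 / ξ) (Or.inl ht.1.ne')).mul
      (hasDerivAt_PiFn (μ := μ) (ν := ν) hlam ht)
    have h2 : deriv (fun x => x ^ (1 / μ - 1 / ξ) * PiFn lam μ ν x) t = _ := h1.deriv
    rw [h2]
    have e1 : t ^ (1 / ξ - 1 / μ + 1) * t ^ (1 / μ - 1 / ξ - 1) = 1 := by
      rw [← Real.rpow_add ht.1]; ring_nf; simp
    have e2 : t ^ (1 / ξ - 1 / μ + 1) * t ^ (1 / μ - 1 / ξ) * t ^ (1 / ν - 1 - 1 / μ)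
        = t ^ (1 / ν - 1 / μ) := by
      rw [← Real.rpow_add ht.1, ← Real.rpow_add ht.1]; ring_nf
    have e3 : ξ * (1 / μ - 1 / ξ) = ξ / μ - 1 := by field_simp
    linear_combination (ξ * (1 / μ - 1 / ξ) * PiFn lam μ ν t) * e1
      - ξ * LambdaFn lam ν t * e2 + PiFn lam μ ν t * e3

theorem pascuWeight_eq {t : ℝ} (ht : 0 < t) : pascuWeight lam ξ μ ν t = t ^ (1 / μ - 1) *
    ((1 - ξ / μ) * PiFn lam μ ν t + ξ * (t ^ (1 / ν - 1 / μ) * LambdaFn lam ν t)) := by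
  have e : t ^ (1 / μ - 1) * t ^ (1 / ν - 1 / μ) = t ^ (1 / ν - 1) := by
    rw [← Real.rpow_add ht]; ring_nf
  unfold pascuWeight
  linear_combination -ξ * LambdaFn lam ν t * e

theorem pascuWeight_pos (hξ₀ : 0 ≤ ξ) (hξ₁ : ξ ≤ 1) (hμ : 1 ≤ μ)
    (hPi_pos : ∀ t ∈ Ioo (0 : ℝ) 1, 0 < PiFn lam μ ν t)
    (hLambda_pos : ∀ t ∈ Ioo (0 : ℝ) 1, 0 < LambdaFn lam ν t) {t : ℝ} (ht : t ∈ Ioo (0 : ℝ) 1) :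
    0 < pascuWeight lam ξ μ ν t := by
  have h1 := mul_pos (Real.rpow_pos_of_pos ht.1 (1 / μ - 1)) (hPi_pos t ht)
  have h2 := mul_pos (Real.rpow_pos_of_pos ht.1 (1 / ν - 1)) (hLambda_pos t ht)
  have h3 : ξ / μ ≤ 1 := (div_le_one (by linarith)).2 (hξ₁.trans hμ)
  unfold pascuWeight
  -- The first term of the weight may vanish (`ξ = μ = 1`), and the second does so for `ξ = 0`, but
  -- never both.
  rcases hξ₀.eq_or_lt with h | h
  · simpa [← h] using h1
  · exact add_pos_of_nonneg_of_pos (mul_nonneg (by linarith) h1.le) (mul_pos h h2)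

/-- The function is `t^{1/μ-1}` times the negative of the quotient assumed increasing. Since `μ ≥
1`, both factors are nonnegative and decreasing. -/
theorem pascuWeight_div_antitoneOn (hlam : IntegrableOn lam (Icc 0 1)) (hμ : 1 ≤ μ)
    (hpos : ∀ t ∈ Ioo (0 : ℝ) 1, 0 < pascuWeight lam ξ μ ν t)
    (hmono : MonotoneOn (pascuQuotient lam ξ μ ν) (Ioo 0 1)) :
    AntitoneOn (fun t => pascuWeight lam ξ μ ν t / (1 - t ^ 2)) (Ioo 0 1) := by
  have hsq : ∀ t ∈ Ioo (0 : ℝ) 1, 0 < 1 - t ^ 2 := fun t ht => by nlinarith [ht.1, ht.2]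
  have e : ∀ t ∈ Ioo (0 : ℝ) 1, pascuWeight lam ξ μ ν t / (1 - t ^ 2) =
      t ^ (1 / μ - 1) * (-pascuQuotient lam ξ μ ν t) := fun t ht => by
    rw [pascuQuotient_eq hlam ht, pascuWeight_eq ht.1]
    ring
  intro s hs t ht hst
  simp only [e s hs, e t ht]
  have hexp : 1 / μ - 1 ≤ 0 := sub_nonpos.2 ((div_le_one (by linarith)).2 hμ)
  have hq : 0 ≤ -pascuQuotient lam ξ μ ν t := by
    have h := div_pos (hpos t ht) (hsq t ht)
    rw [e t ht] at h
    exact ((mul_pos_iff_of_pos_left (Real.rpow_pos_of_pos ht.1 _)).1 h).le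
  exact mul_le_mul (Real.rpow_le_rpow_of_nonpos hs.1 hst hexp) (neg_le_neg (hmono hs ht hst)) hq
    (Real.rpow_nonneg hs.1.le _)

/-- Integrals against the weight are integrals of iterated Hardy means against `lam`. -/
theorem integral_pascuWeight_mul (hlam : IntegrableOn lam (Icc 0 1)) (hμ : 0 < μ) (hν : 0 < ν)
    {ψ : ℝ → ℝ} (hψ : BddContOnUnit ψ) :
    IntegrableOn (fun t => pascuWeight lam ξ μ ν t * ψ t) (Ioo 0 1) ∧
    ∫ t in Ioo (0 : ℝ) 1, pascuWeight lam ξ μ ν t * ψ t =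
      ∫ t in Ioo (0 : ℝ) 1, lam t * ((1 - ξ / μ) * hardyMean (1 / ν) (hardyMean (1 / μ) ψ) t +
        ξ * hardyMean (1 / ν) ψ t) := by
  have ha : 0 < 1 / μ := by positivity
  have hb : 0 < 1 / ν := by positivity
  have hlam' : IntegrableOn lam (Ioo 0 1) := hlam.mono_set Ioo_subset_Icc_self
  have tailL : ∀ φ, BddContOnUnit φ →
      IntegrableOn (fun t => t ^ (1 / ν - 1) * LambdaFn lam ν t * φ t) (Ioo 0 1) ∧
      ∫ t in Ioo (0 : ℝ) 1, t ^ (1 / ν - 1) * LambdaFn lam ν t * φ t =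
        ∫ t in Ioo (0 : ℝ) 1, lam t * hardyMean (1 / ν) φ t := by
    intro φ hφ
    obtain ⟨h1, h2⟩ := hφ.integral_tail_mul hlam' hb
    have e : ∀ t ∈ Ioo (0 : ℝ) 1, t ^ (1 / ν - 1) * (∫ x in t..1, lam x * x ^ (-(1 / ν))) * φ t =
        t ^ (1 / ν - 1) * LambdaFn lam ν t * φ t := fun t ht => by rw [LambdaFn_eq ht]
    exact ⟨h1.congr_fun e measurableSet_Ioo,
      (setIntegral_congr_fun measurableSet_Ioo e).symm.trans h2⟩
  -- The constant test function yields the integrability of the density in `Π`, so that Fubini can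
  -- be applied a second time.
  have hκ : IntegrableOn (fun t => t ^ (1 / ν - 1) * LambdaFn lam ν t) (Ioo 0 1) := by
    simpa using (tailL (fun _ => 1) (.of_continuousOn_Icc continuousOn_const)).1
  have tailP : IntegrableOn (fun t => t ^ (1 / μ - 1) * PiFn lam μ ν t * ψ t) (Ioo 0 1) ∧
      ∫ t in Ioo (0 : ℝ) 1, t ^ (1 / μ - 1) * PiFn lam μ ν t * ψ t =
        ∫ t in Ioo (0 : ℝ) 1, lam t * hardyMean (1 / ν) (hardyMean (1 / μ) ψ) t := by
    obtain ⟨h1, h2⟩ := hψ.integral_tail_mul hκ ha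
    have e : ∀ t ∈ Ioo (0 : ℝ) 1, t ^ (1 / μ - 1) * (∫ x in t..1,
        (x ^ (1 / ν - 1) * LambdaFn lam ν x) * x ^ (-(1 / μ))) * ψ t =
        t ^ (1 / μ - 1) * PiFn lam μ ν t * ψ t := fun t ht => by rw [PiFn_eq ht]
    exact ⟨h1.congr_fun e measurableSet_Ioo,
      (setIntegral_congr_fun measurableSet_Ioo e).symm.trans
        (h2.trans (tailL _ (hψ.hardyMean ha)).2)⟩
  obtain ⟨hL1, hL2⟩ := tailL ψ hψ
  obtain ⟨hP1, hP2⟩ := tailP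
  have e : (fun t => pascuWeight lam ξ μ ν t * ψ t) = fun t =>
      (1 - ξ / μ) * (t ^ (1 / μ - 1) * PiFn lam μ ν t * ψ t) +
        ξ * (t ^ (1 / ν - 1) * LambdaFn lam ν t * ψ t) := by
    ext t; unfold pascuWeight; ring
  rw [e]
  refine ⟨(hP1.const_mul _).add (hL1.const_mul _), ?_⟩
  rw [integral_add (hP1.const_mul _) (hL1.const_mul _), integral_const_mul, integral_const_mul,
    hP2, hL2, ← integral_const_mul, ← integral_const_mul, ← integral_add]
  · congr 1
    ext t
    ring
  · exact ((hψ.hardyMean ha).hardyMean hb).integrableOn_mul hlam' |>.const_mul _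
  · exact ((hψ.hardyMean hb).integrableOn_mul hlam').const_mul _

theorem integrableOn_pascuWeight (hlam : IntegrableOn lam (Icc 0 1)) (hμ : 0 < μ) (hν : 0 < ν) :
    IntegrableOn (pascuWeight lam ξ μ ν) (Ioo 0 1) := by
  simpa using (integral_pascuWeight_mul (ξ := ξ) hlam hμ hν (ψ := fun _ => 1)
    (.of_continuousOn_Icc continuousOn_const)).1

/-- The eigenvalues combine through `(1 - ξ/μ) + ξ(1/μ + n) = 1 + ξn`. -/
theorem integral_pascuWeight_mul_pow (hlam : IntegrableOn lam (Icc 0 1)) (hμ : 0 < μ)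
    (hν : 0 < ν) (n : ℕ) :
    1 / (μ * ν) * ∫ t in Ioo (0 : ℝ) 1, pascuWeight lam ξ μ ν t * t ^ n =
      (1 + ξ * n) / ((1 + n * μ) * (1 + n * ν)) * ∫ t in Ioo (0 : ℝ) 1, lam t * t ^ n := by
  have ha : 0 < 1 / μ := by positivity
  have hb : 0 < 1 / ν := by positivity
  rw [(integral_pascuWeight_mul hlam hμ hν
    (.of_continuousOn_Icc (by fun_prop : ContinuousOn (fun t : ℝ => t ^ n) (Icc 0 1)))).2,
    ← integral_const_mul, ← integral_const_mul]
  refine setIntegral_congr_fun measurableSet_Ioo fun t ht => ?_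
  have e : hardyMean (1 / ν) (hardyMean (1 / μ) fun t => t ^ n) t =
      (1 / μ + n)⁻¹ * (t ^ n / (1 / ν + n)) := by
    rw [hardyMean_congr (χ := fun t => (1 / μ + n)⁻¹ * t ^ n) (fun s hs => ?_) ht,
      hardyMean_const_mul, hardyMean_pow hb n ht.1]
    rw [hardyMean_pow ha n hs.1, div_eq_inv_mul]
  simp only [e, hardyMean_pow hb n ht.1]
  have hn : (0 : ℝ) ≤ n := n.cast_nonneg
  have h1 : 1 + n * μ ≠ 0 := by positivity
  have h2 : 1 + n * ν ≠ 0 := by positivity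
  have h3 : 1 / μ + n = (1 + n * μ) / μ := by field_simp
  have h4 : 1 / ν + n = (1 + n * ν) / ν := by field_simp
  rw [h3, h4]
  field_simp
  ring

/-- With `A` the double and `B` the single Hardy mean of `(1 + t)⁻²`, one has `1 + g = 2A/(μν)` and
`q = (B + (1 - 1/μ)A)/(μν)`. The combination with `ξ` is then `(2/(μν))((1 - ξ/μ)A + ξB) - 1`, the
very means that are dual to the weight. -/
theorem integral_eq_pascuWeight {g q : ℝ → ℝ} (hlam : IntegrableOn lam (Icc 0 1))
    (hlam_one : ∫ t in (0 : ℝ)..1, lam t = 1) (hμ : 0 < μ)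
    (hν : 0 < ν) (hg : IsSolutionG μ ν g) (hq : IsSolutionQ μ ν q) :
    ∫ t in (0 : ℝ)..1, lam t * ((1 - ξ) * g t + ξ * (2 * q t - 1)) =
      2 * (1 / (μ * ν) * ∫ t in Ioo (0 : ℝ) 1, pascuWeight lam ξ μ ν t * (1 / (1 + t) ^ 2)) - 1 := by
  have ha : 0 < 1 / μ := by positivity
  have hb : 0 < 1 / ν := by positivity
  have hlam' : IntegrableOn lam (Ioo 0 1) := hlam.mono_set Ioo_subset_Icc_self
  have c2 : BddContOnUnit fun t : ℝ => 1 / (1 + t) ^ 2 := .of_continuousOn_Icc <|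
    ContinuousOn.div (by fun_prop) (by fun_prop) fun t ht => by have := ht.1; positivity
  have c3 : BddContOnUnit fun t : ℝ => (1 - t) / (1 + t) ^ 3 := .of_continuousOn_Icc <|
    ContinuousOn.div (by fun_prop) (by fun_prop) fun t ht => by have := ht.1; positivity
  obtain ⟨-, hgc, hgd⟩ := hg
  obtain ⟨-, hqc, hqd⟩ := hq
  set A := hardyMean (1 / ν) (hardyMean (1 / μ) fun t => 1 / (1 + t) ^ 2) with hA
  set B := hardyMean (1 / ν) (fun t => 1 / (1 + t) ^ 2) with hB
  have hgA : ∀ t ∈ Ioo (0 : ℝ) 1, 1 + g t = 2 / (μ * ν) * A t := by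
    intro t ht
    rw [hA, ← hardyMean_const_mul]
    refine ((c2.hardyMean ha).const_mul (2 / (μ * ν))).eq_hardyMean_of_hasDerivAt hb
      (continuousWithinAt_const.add hgc) (fun s hs => ?_) ht
    refine (hgd s hs).congr_deriv ?_
    rw [← integral_scaled_eq_hardyMean hs.1]
    simp only [mul_one_div]
    ring
  have hqA : ∀ t ∈ Ioo (0 : ℝ) 1, q t = 1 / (μ * ν) * (B t + (1 - 1 / μ) * A t) := by
    intro t ht
    have h1 := ((c3.hardyMean ha).const_mul (1 / (μ * ν))).eq_hardyMean_of_hasDerivAt hb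
      hqc (fun s hs => by
        refine (hqd s hs).congr_deriv ?_
        rw [← integral_scaled_eq_hardyMean hs.1]
        ring) ht
    rw [h1, hardyMean_const_mul, hardyMean_congr (fun s hs => hardyMean_deriv_kernel ha hs) ht,
      hardyMean_add hb c2 ((c2.hardyMean ha).const_mul _) ht, hardyMean_const_mul]
  rw [(integral_pascuWeight_mul hlam hμ hν c2).2]
  have hone : ∫ t in Ioo (0 : ℝ) 1, lam t = 1 := by
    rwa [intervalIntegral.integral_of_le zero_le_one, integral_Ioc_eq_integral_Ioo] at hlam_one
  rw [show ∀ X : ℝ, X - 1 = X - ∫ t in Ioo (0 : ℝ) 1, lam t from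
    fun X => congrArg (X - ·) hone.symm]
  rw [← mul_assoc, ← integral_const_mul, ← integral_sub _ hlam',
    intervalIntegral.integral_of_le zero_le_one, integral_Ioc_eq_integral_Ioo]
  · refine setIntegral_congr_fun measurableSet_Ioo fun t ht => ?_
    have h1 : g t = 2 / (μ * ν) * A t - 1 := by linarith [hgA t ht]
    simp only [h1, hqA t ht, ← hA, ← hB]
    field_simp
    ring
  · exact ((((c2.hardyMean ha).hardyMean hb).const_mul _).add
      ((c2.hardyMean hb).const_mul _)).integrableOn_mul hlam' |>.const_mul _

end Weight

/-! ### Starlike test functions and the dual multiplier -/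

theorem powerSum_zero (a : ℕ → ℂ) : powerSum a 0 = a 0 := by
  unfold powerSum
  rw [tsum_eq_single 0 fun n hn => by simp [hn]]
  simp

theorem absConvOnDisc_one : AbsConvOnDisc fun _ => 1 := fun r h0 h1 => by
  simpa using summable_geometric_of_lt_one h0 h1

theorem absConvOnDisc_single (c : ℂ) : AbsConvOnDisc fun n => if n = 0 then c else 0 :=
  fun r _ _ => summable_of_ne_finset_zero (s := {0}) fun n hn => by
    simp at hn; simp [hn]

theorem powerSum_single (c z : ℂ) : powerSum (fun n => if n = 0 then c else 0) z = c := by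
  unfold powerSum
  rw [tsum_eq_single 0 fun n hn => by simp [hn]]
  simp

/-- Coefficients of the starlike test function `(1 + (ε - 1)/2 w) / (1 - w)²`. -/
noncomputable def starlikeCoeff (ε : ℂ) (n : ℕ) : ℂ := 1 + (1 + ε) / 2 * n

theorem absConvOnDisc_starlikeCoeff (ε : ℂ) : AbsConvOnDisc (starlikeCoeff ε) := by
  have h := absConvOnDisc_one.add (absConvOnDisc_one.nat_mul.const_mul ((1 + ε) / 2))
  change AbsConvOnDisc fun n => 1 + (1 + ε) / 2 * (n : ℂ)
  simpa using h

theorem hasSum_starlikeCoeff (ε : ℂ) {w : ℂ} (hw : ‖w‖ < 1) :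
    HasSum (fun n => starlikeCoeff ε n * w ^ n) ((1 + (ε - 1) / 2 * w) / (1 - w) ^ 2) := by
  have h := (hasSum_geometric_of_norm_lt_one hw).add
    ((hasSum_coe_mul_geometric_of_norm_lt_one hw).mul_left ((1 + ε) / 2))
  have hne : 1 - w ≠ 0 := sub_ne_zero.2 fun h => by simp [← h] at hw
  have e : (1 - w)⁻¹ + (1 + ε) / 2 * (w / (1 - w) ^ 2) =
      (1 + (ε - 1) / 2 * w) / (1 - w) ^ 2 := by
    field_simp
    ring
  rw [e] at h
  exact h.congr_fun fun n => by unfold starlikeCoeff; ring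

/-- Integrating a power series termwise along the rays of the disc. -/
theorem AbsConvOnDisc.hasSum_integral_ray {a : ℕ → ℂ} (ha : AbsConvOnDisc a) {W : ℝ → ℝ}
    (hW : IntegrableOn W (Ioo 0 1)) {z : ℂ} (hz : ‖z‖ < 1) :
    HasSum (fun n => ((∫ t in Ioo (0 : ℝ) 1, W t * t ^ n : ℝ) : ℂ) * a n * z ^ n)
      (∫ t in Ioo (0 : ℝ) 1, (W t : ℂ) * powerSum a (t * z)) := by
  have hs := ha.summable_norm hz
  have hnorm : ∀ t ∈ Ioo (0 : ℝ) 1, ‖(t : ℂ) * z‖ < 1 := fun t ht => by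
    rw [norm_mul, Complex.norm_real, Real.norm_of_nonneg ht.1.le]
    exact mul_lt_one_of_nonneg_of_lt_one_left ht.1.le ht.2 hz.le
  have h := hasSum_integral_of_dominated_convergence (μ := volume.restrict (Ioo (0 : ℝ) 1))
    (F := fun n t => (W t : ℂ) * (a n * (t * z) ^ n))
    (f := fun t : ℝ => (W t : ℂ) * powerSum a (t * z)) (fun n t => |W t| * ‖a n * z ^ n‖)
    (fun n => (Complex.continuous_ofReal.comp_aestronglyMeasurable hW.aestronglyMeasurable).mul
      (Continuous.aestronglyMeasurable (by fun_prop)))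
    (fun n => (ae_restrict_iff' measurableSet_Ioo).2 <| Filter.Eventually.of_forall fun t ht => by
      rw [norm_mul, Complex.norm_real, Real.norm_eq_abs, mul_pow, norm_mul, norm_mul, norm_mul,
        norm_pow (t : ℂ), Complex.norm_real, Real.norm_of_nonneg ht.1.le]
      have h1 : t ^ n ≤ 1 := pow_le_one₀ ht.1.le ht.2.le
      gcongr
      exact mul_le_of_le_one_left (norm_nonneg _) h1)
    (Filter.Eventually.of_forall fun t => hs.mul_left _)
    (by
      simp_rw [tsum_mul_left]
      exact hW.abs.mul_const _)
    ((ae_restrict_iff' measurableSet_Ioo).2 <| Filter.Eventually.of_forall fun t ht =>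
      (ha.hasSum (hnorm t ht)).mul_left (W t : ℂ))
  refine h.congr_fun fun n => ?_
  rw [mul_assoc, ← integral_complex_ofReal, ← integral_mul_const]
  congr 1
  ext t
  push_cast
  ring

/-- Coefficients of the Hadamard multiplier that encodes `V_λ`, the class `W` and the class `M`. -/
noncomputable def dualCoeff (lam : ℝ → ℝ) (ξ μ ν : ℝ) (ε : ℂ) (n : ℕ) : ℂ :=
  (((1 + ξ * n) / ((1 + n * μ) * (1 + n * ν)) * ∫ t in Ioo (0 : ℝ) 1, lam t * t ^ n : ℝ) : ℂ) *
    starlikeCoeff ε n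

section Dual

variable {lam : ℝ → ℝ} {μ ν ξ : ℝ}

theorem norm_integral_mul_pow_le (hlam : IntegrableOn lam (Ioo 0 1)) (n : ℕ) :
    |∫ t in Ioo (0 : ℝ) 1, lam t * t ^ n| ≤ ∫ t in Ioo (0 : ℝ) 1, |lam t| := by
  rw [← Real.norm_eq_abs]
  refine norm_integral_le_of_norm_le hlam.abs ((ae_restrict_iff' measurableSet_Ioo).2 <|
    Filter.Eventually.of_forall fun t ht => ?_)
  rw [norm_mul, norm_pow, Real.norm_of_nonneg ht.1.le, Real.norm_eq_abs]
  exact mul_le_of_le_one_right (abs_nonneg _) (pow_le_one₀ ht.1.le ht.2.le)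

/-- From `ξ ≤ 1 ≤ μ` follows `1 + ξn ≤ (1 + nμ)(1 + nν)`, so the factor multiplying the starlike
coefficients is bounded. -/
theorem absConvOnDisc_dualCoeff (hlam : IntegrableOn lam (Ioo 0 1)) (hξ₀ : 0 ≤ ξ) (hξ₁ : ξ ≤ 1)
    (hμ : 1 ≤ μ) (hν : 0 < ν) (ε : ℂ) : AbsConvOnDisc (dualCoeff lam ξ μ ν ε) := by
  refine (absConvOnDisc_starlikeCoeff ε).bounded_mul
    (C := 1 * ∫ t in Ioo (0 : ℝ) 1, |lam t|) fun n => ?_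
  have hn : (0 : ℝ) ≤ n := n.cast_nonneg
  rw [Complex.norm_real, norm_mul]
  refine mul_le_mul ?_ (norm_integral_mul_pow_le hlam n) (norm_nonneg _) zero_le_one
  rw [Real.norm_of_nonneg (by positivity), div_le_one (by positivity)]
  have h1 : ξ * n ≤ n * μ := by nlinarith
  have h2 : 0 ≤ (1 + n * μ) * (n * ν) := by positivity
  linarith

theorem powerSum_dualCoeff (hlam : IntegrableOn lam (Icc 0 1)) (hμ : 0 < μ) (hν : 0 < ν)
    (ε : ℂ) {z : ℂ} (hz : ‖z‖ < 1) :
    (powerSum (dualCoeff lam ξ μ ν ε) z).re = 1 / (μ * ν) * ∫ t in Ioo (0 : ℝ) 1,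
      pascuWeight lam ξ μ ν t * ((1 + (ε - 1) / 2 * (t * z)) / (1 - t * z) ^ 2).re := by
  have hW := integrableOn_pascuWeight (ξ := ξ) hlam hμ hν
  have hnorm : ∀ t ∈ Icc (0 : ℝ) 1, ‖(t : ℂ) * z‖ < 1 := fun t ht => by
    rw [norm_mul, Complex.norm_real, Real.norm_of_nonneg ht.1]
    exact (mul_le_of_le_one_left (norm_nonneg z) ht.2).trans_lt hz
  have h := ((absConvOnDisc_starlikeCoeff ε).hasSum_integral_ray hW hz).mul_left
    ((1 / (μ * ν) : ℝ) : ℂ)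
  have e1 : powerSum (dualCoeff lam ξ μ ν ε) z = ((1 / (μ * ν) : ℝ) : ℂ) *
      ∫ t in Ioo (0 : ℝ) 1, (pascuWeight lam ξ μ ν t : ℂ) * powerSum (starlikeCoeff ε) (t * z) := by
    rw [← h.tsum_eq]
    refine tsum_congr fun n => ?_
    unfold dualCoeff
    rw [← integral_pascuWeight_mul_pow hlam hμ hν n]
    push_cast
    ring
  have e2 : ∀ t ∈ Ioo (0 : ℝ) 1,
      (pascuWeight lam ξ μ ν t : ℂ) * powerSum (starlikeCoeff ε) (t * z) =
      (pascuWeight lam ξ μ ν t : ℂ) * ((1 + (ε - 1) / 2 * (t * z)) / (1 - t * z) ^ 2) :=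
    fun t ht => by
      rw [powerSum, (hasSum_starlikeCoeff ε (hnorm t (Ioo_subset_Icc_self ht))).tsum_eq]
  have hint : IntegrableOn (fun t : ℝ => (pascuWeight lam ξ μ ν t : ℂ) *
      ((1 + (ε - 1) / 2 * (t * z)) / (1 - t * z) ^ 2)) (Ioo 0 1) := by
    have hWc : IntegrableOn (fun t => (pascuWeight lam ξ μ ν t : ℂ)) (Ioo 0 1) := hW.ofReal
    rw [← integrableOn_Icc_iff_integrableOn_Ioo] at hWc ⊢
    refine hWc.mul_continuousOn (ContinuousOn.div (by fun_prop) (by fun_prop) fun t ht => ?_)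
      isCompact_Icc
    refine pow_ne_zero 2 (sub_ne_zero.2 fun h => ?_)
    have := hnorm t ht
    simp [← h] at this
  rw [e1, Complex.re_ofReal_mul, setIntegral_congr_fun measurableSet_Ioo e2]
  congr 1
  have h3 := Complex.reCLM.integral_comp_comm hint
  simp only [Complex.reCLM_apply, Complex.re_ofReal_mul] at h3
  exact h3.symm

end Dual

/-! ### The classes `W` and `M` in terms of coefficients -/

section Derivatives

variable {A : ℕ → ℂ} {G : ℂ → ℂ}

theorem AbsConvOnDisc.succ_mul (hA : AbsConvOnDisc A) :
    AbsConvOnDisc fun n => ((n : ℂ) + 1) * A n := by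
  simpa only [add_mul, one_mul] using hA.nat_mul.add hA

theorem AbsConvOnDisc.mul_powerSum_deriv (hA : AbsConvOnDisc A) {z : ℂ} (hz : ‖z‖ < 1) :
    z * powerSum (fun n => ((n + 1 : ℕ) : ℂ) * A (n + 1)) z =
      powerSum (fun n => (n : ℂ) * A n) z := by
  rw [hA.nat_mul.powerSum_eq_shift hz]
  simp

theorem AbsConvOnDisc.hasDerivAt_of_eq_mul (hA : AbsConvOnDisc A)
    (hG : ∀ z, ‖z‖ < 1 → G z = z * powerSum A z) {z : ℂ} (hz : ‖z‖ < 1) :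
    HasDerivAt G (powerSum (fun n => ((n : ℂ) + 1) * A n) z) z := by
  have h := (hasDerivAt_id z).mul (hA.hasDerivAt hz)
  have hev : G =ᶠ[nhds z] fun z => z * powerSum A z := by
    filter_upwards [Metric.isOpen_ball.mem_nhds (mem_unitDisc.2 hz : z ∈ Metric.ball (0 : ℂ) 1)]
      with w hw
    exact hG w (mem_unitDisc.1 hw)
  refine (HasDerivAt.congr_of_eventuallyEq h hev).congr_deriv ?_
  simp only [id, one_mul, add_mul]
  rw [hA.mul_powerSum_deriv hz, hA.nat_mul.powerSum_add hA hz, add_comm]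

end Derivatives

/-- A quotient has positive real part if it avoids all values `-(1 - ε) / (1 + ε)`, `|ε| ≤ 1`. -/
theorem ne_zero_and_re_div_pos {X Y : ℂ}
    (h : ∀ ε : ℂ, ‖ε‖ ≤ 1 → (1 + ε) * X + (1 - ε) * Y ≠ 0) : Y ≠ 0 ∧ 0 < (X / Y).re := by
  have hY : Y ≠ 0 := fun hY => h (-1) (by simp) (by simp [hY])
  refine ⟨hY, ?_⟩
  by_contra hre
  push Not at hre
  set k := X / Y with hk
  have hX : X = k * Y := by rw [hk]; field_simp
  have hne : 1 - k ≠ 0 := fun h0 => by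
    have : k = 1 := (sub_eq_zero.1 h0).symm
    rw [this] at hre; norm_num at hre
  -- This `ε` makes the linear combination vanish; the Cayley transform maps the closed left half
  -- plane into the closed unit disc.
  refine h ((1 + k) / (1 - k)) ?_ ?_
  · rw [norm_div]
    refine div_le_one_of_le₀ ?_ (norm_nonneg _)
    refine le_of_sq_le_sq ?_ (norm_nonneg _)
    rw [Complex.sq_norm, Complex.sq_norm, Complex.normSq_apply, Complex.normSq_apply]
    simp
    nlinarith
  · rw [hX]
    field_simp
    ring

/-- The Hadamard product of the dual multiplier with the power series of a function whose values
lie in a half plane bounded by a line through `β` does not vanish. -/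
theorem powerSum_dualCoeff_mul_ne_zero {μ ν ξ β φ : ℝ} {lam g q : ℝ → ℝ} {k : ℕ → ℂ} {z ε : ℂ}
    (hν : 0 < ν) (hlam : IntegrableOn lam (Icc 0 1)) (hlam_one : ∫ t in (0 : ℝ)..1, lam t = 1)
    (hPi_pos : ∀ t ∈ Ioo (0 : ℝ) 1, 0 < PiFn lam μ ν t)
    (hLambda_pos : ∀ t ∈ Ioo (0 : ℝ) 1, 0 < LambdaFn lam ν t)
    (hξ₀ : 0 ≤ ξ) (hξ₁ : ξ ≤ 1) (hμ : 1 ≤ μ)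
    (hmono : MonotoneOn (pascuQuotient lam ξ μ ν) (Ioo 0 1))
    (hg : IsSolutionG μ ν g) (hq : IsSolutionQ μ ν q) (hβ : β < 1)
    (hβ_eq : β / (1 - β) =
      -∫ t in (0 : ℝ)..1, lam t * ((1 - ξ) * g t + ξ * (2 * q t - 1)))
    (hk : AbsConvOnDisc k) (hk0 : k 0 = 1)
    (hkre : ∀ w, ‖w‖ < 1 → 0 < (Complex.exp (Complex.I * φ) * (powerSum k w - β)).re)
    (hz : ‖z‖ < 1) (hε : ‖ε‖ ≤ 1) :
    powerSum (fun n => dualCoeff lam ξ μ ν ε n * k n) z ≠ 0 := by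
  have hμ0 : 0 < μ := by linarith
  have hlam' : IntegrableOn lam (Ioo 0 1) := hlam.mono_set Ioo_subset_Icc_self
  have hc := absConvOnDisc_dualCoeff hlam' hξ₀ hξ₁ hμ hν ε
  set c := dualCoeff lam ξ μ ν ε with hcdef
  set e := Complex.exp (Complex.I * φ) with he
  have hc0 : c 0 = 1 := by
    have hone : ∫ t in Ioo (0 : ℝ) 1, lam t = 1 := by
      rwa [intervalIntegral.integral_of_le zero_le_one, integral_Ioc_eq_integral_Ioo] at hlam_one
    simp [hcdef, dualCoeff, starlikeCoeff, hone]
  have hWpos := fun t ht => pascuWeight_pos (t := t) hξ₀ hξ₁ hμ hPi_pos hLambda_pos ht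
  -- By the equation for `β`, this is exactly the extremal inequality, scaled by `2/(μν)`.
  have hU : ∀ w, ‖w‖ < 1 → 0 < (2 * powerSum c w - 1 + (β / (1 - β) : ℝ)).re := by
    intro w hw
    have h1 := integral_weight_lt_integral_starlike_kernel
      (integrableOn_pascuWeight hlam hμ0 hν) hWpos
      (pascuWeight_div_antitoneOn hlam hμ hWpos hmono) hw hε
    have h2 := powerSum_dualCoeff (ξ := ξ) hlam hμ0 hν ε hw
    rw [integral_eq_pascuWeight hlam hlam_one hμ0 hν hg hq] at hβ_eq
    have h3 := mul_lt_mul_of_pos_left h1 (by positivity : 0 < 1 / (μ * ν))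
    rw [← h2] at h3
    rw [Complex.add_re, Complex.ofReal_re, hβ_eq]
    simp only [Complex.sub_re, Complex.mul_re, Complex.re_ofNat, Complex.im_ofNat, zero_mul,
      sub_zero, Complex.one_re]
    linarith
  have hsub : AbsConvOnDisc fun n => k n + if n = 0 then -(β : ℂ) else 0 :=
    hk.add (absConvOnDisc_single _)
  have hK : AbsConvOnDisc fun n => e * (k n + if n = 0 then -(β : ℂ) else 0) :=
    hsub.const_mul e
  have hKsum : ∀ w, ‖w‖ < 1 →
      powerSum (fun n => e * (k n + if n = 0 then -(β : ℂ) else 0)) w =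
        e * (powerSum k w - β) := fun w hw => by
    rw [hsub.powerSum_const_mul e hw, hk.powerSum_add (absConvOnDisc_single _) hw,
      powerSum_single, sub_eq_add_neg]
  have hmain := hK.re_hadamard_pos hc (fun w hw => by rw [hKsum w hw]; exact hkre w hw) hU hc0 hz
  intro hzero
  -- If the Hadamard product of `c` and `k` vanishes at `z`, subtracting `β` from `k` leaves only
  -- the constant term, as `c 0 = 1`.
  have hprod : powerSum (fun n => c n * (e * (k n + if n = 0 then -(β : ℂ) else 0))) z =
      -(e * β) := by
    have hck : HasSum (fun n => c n * k n * z ^ n) 0 := by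
      rw [← hzero]
      exact (hc.mul hk).hasSum hz
    have h1 := (hck.add ((absConvOnDisc_single (-(β : ℂ))).hasSum hz)).mul_left e
    rw [powerSum_single] at h1
    refine HasSum.tsum_eq ?_ |>.trans (by ring : e * (0 + -(β : ℂ)) = _)
    refine h1.congr_fun fun n => ?_
    by_cases hn : n = 0
    · simp [hn, hc0]
    · simp [hn]; ring
  rw [hprod] at hmain
  simp only [hk0, if_true] at hmain
  have hδ : (β / (1 - β) - 1) * (1 - β) = β - (1 - β) := by
    have : 1 - β ≠ 0 := by linarith
    field_simp
  have h4 : (e * (1 + -(β : ℂ))).re = (1 - β) * e.re := by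
    rw [show (1 + -(β : ℂ)) = ((1 - β : ℝ) : ℂ) by push_cast; ring, Complex.re_mul_ofReal]
    ring
  -- The constants balance: `-β + (1 - β) + (β/(1 - β) - 1)(1 - β) = 0`, which contradicts strict
  -- positivity for every `φ`.
  have h5 : (-(e * (β : ℂ)) + star (e * (1 + -(β : ℂ))) +
      (((β / (1 - β) : ℝ) : ℂ) - 1) * ((e * (1 + -(β : ℂ))).re : ℂ)).re = 0 := by
    rw [h4, show (((β / (1 - β) : ℝ) : ℂ) - 1) * (((1 - β) * e.re : ℝ) : ℂ) =
      (((β / (1 - β) - 1) * (1 - β) * e.re : ℝ) : ℂ) by push_cast; ring, hδ, Complex.add_re,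
      Complex.add_re, Complex.ofReal_re, Complex.neg_re, Complex.re_mul_ofReal]
    have : (star (e * (1 + -(β : ℂ)))).re = (e * (1 + -(β : ℂ))).re := Complex.conj_re _
    rw [this, h4]
    ring
  rw [h5] at hmain
  exact lt_irrefl _ hmain

/-- After division by `z`, the numerator and the denominator of the quotient have the coefficients
`(n + 1)(1 + ξn)Aₙ` and `(1 + ξn)Aₙ`. Weighting them by `(1 + ε)/2` and `(1 - ε)/2` gives the factor
`1 + (1 + ε)n/2` of the test function. -/
theorem mem_classM_of_powerSum {A : ℕ → ℂ} {G : ℂ → ℂ} {ξ : ℝ} (hA : AbsConvOnDisc A)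
    (hG : ∀ z, ‖z‖ < 1 → G z = z * powerSum A z) (hA0 : A 0 = 1)
    (h : ∀ z ε : ℂ, ‖z‖ < 1 → ‖ε‖ ≤ 1 →
      powerSum (fun n => starlikeCoeff ε n * ((1 + ξ * n) * A n)) z ≠ 0) : G ∈ classM ξ := by
  have hA1 := hA.succ_mul
  have hG1 : ∀ z, ‖z‖ < 1 → deriv G z = powerSum (fun n => ((n : ℂ) + 1) * A n) z :=
    fun z hz => (hA.hasDerivAt_of_eq_mul hG hz).deriv
  have hG2 : ∀ z, ‖z‖ < 1 → deriv (fun w => w * deriv G w) z =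
      powerSum (fun n => ((n : ℂ) + 1) * (((n : ℂ) + 1) * A n)) z := fun z hz =>
    (hA1.hasDerivAt_of_eq_mul (fun w hw => by rw [hG1 w hw]) hz).deriv
  refine ⟨⟨fun z hz => (hA.hasDerivAt_of_eq_mul hG
    (mem_unitDisc.1 hz)).differentiableAt.differentiableWithinAt, ?_, ?_⟩, ?_⟩
  · rw [hG 0 (by simp), zero_mul]
  · rw [hG1 0 (by simp), powerSum_zero, hA0]; simp
  intro z hz hz0
  have hz := mem_unitDisc.1 hz
  set Y := powerSum (fun n => (1 + ξ * (n : ℂ)) * A n) z with hY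
  set X := powerSum (fun n => ((n : ℂ) + 1) * ((1 + ξ * (n : ℂ)) * A n)) z with hX
  have cY : AbsConvOnDisc fun n => (1 + ξ * (n : ℂ)) * A n := by
    simpa only [add_mul, one_mul, mul_assoc] using hA.add (hA.nat_mul.const_mul (ξ : ℂ))
  have eY : ξ * z * deriv G z + (1 - ξ) * G z = z * Y := by
    have h1 := (hA1.const_mul (ξ : ℂ)).powerSum_add (hA.const_mul (1 - ξ : ℂ)) hz
    rw [hA1.powerSum_const_mul _ hz, hA.powerSum_const_mul _ hz] at h1
    have h2 : Y = powerSum (fun n => ξ * (((n : ℂ) + 1) * A n) + (1 - ξ) * A n) z := by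
      rw [hY]; congr 1; ext n; ring
    rw [h2, h1, hG1 z hz, hG z hz]
    ring
  have eX : ξ * z * deriv (fun w => w * deriv G w) z + (1 - ξ) * (z * deriv G z) = z * X := by
    have h1 := (hA1.succ_mul.const_mul (ξ : ℂ)).powerSum_add (hA1.const_mul (1 - ξ : ℂ)) hz
    rw [hA1.succ_mul.powerSum_const_mul _ hz, hA1.powerSum_const_mul _ hz] at h1
    have h2 : X = powerSum (fun n => ξ * (((n : ℂ) + 1) * (((n : ℂ) + 1) * A n)) +
        (1 - ξ) * (((n : ℂ) + 1) * A n)) z := by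
      rw [hX]; congr 1; ext n; ring
    rw [h2, h1, hG2 z hz, hG1 z hz]
    ring
  have hXY : Y ≠ 0 ∧ 0 < (X / Y).re := by
    refine ne_zero_and_re_div_pos fun ε hε h0 => h z ε hz hε ?_
    have h1 := (cY.succ_mul.const_mul ((1 + ε) / 2)).powerSum_add (cY.const_mul ((1 - ε) / 2)) hz
    rw [cY.succ_mul.powerSum_const_mul _ hz, cY.powerSum_const_mul _ hz] at h1
    have h2 : powerSum (fun n => starlikeCoeff ε n * ((1 + ξ * n) * A n)) z =
        powerSum (fun n => (1 + ε) / 2 * (((n : ℂ) + 1) * ((1 + ξ * (n : ℂ)) * A n)) +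
          (1 - ε) / 2 * ((1 + ξ * (n : ℂ)) * A n)) z := by
      congr 1; ext n; unfold starlikeCoeff; ring
    rw [h2, h1]
    linear_combination h0 / 2
  rw [eX, eY, mul_div_mul_left _ _ hz0]
  exact ⟨mul_ne_zero hz0 hXY.1, hXY.2⟩

/-- The differential expression that defines the class `W`, in terms of Taylor coefficients. -/
theorem exists_coeff_of_mem_classA {f : ℂ → ℂ} (hf : f ∈ classA) {α γ μ ν : ℝ}
    (hsum : μ + ν = α - γ) (hprod : μ * ν = γ) :
    ∃ b : ℕ → ℂ, AbsConvOnDisc b ∧ b 0 = 1 ∧ (∀ z, ‖z‖ < 1 → f z = z * powerSum b z) ∧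
      AbsConvOnDisc (fun n => (1 + n * μ) * (1 + n * ν) * b n) ∧
      ∀ z, ‖z‖ < 1 → (1 - α + 2 * γ) * dslope f 0 z + (α - 2 * γ) * deriv f z
        + γ * z * deriv (deriv f) z =
          powerSum (fun n => (1 + n * μ) * (1 + n * ν) * b n) z := by
  obtain ⟨hdiff, h0, h1⟩ := hf
  obtain ⟨a, ha, hfa⟩ := exists_powerSum_eq hdiff
  have ha0 : a 0 = 0 := by rw [← powerSum_zero a, ← hfa 0 (by simp), h0]
  set b : ℕ → ℂ := fun n => a (n + 1) with hb
  have hbc : AbsConvOnDisc b := ha.shift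
  have hfb : ∀ z, ‖z‖ < 1 → f z = z * powerSum b z := fun z hz => by
    rw [hfa z hz, ha.powerSum_eq_shift hz, ha0, zero_add]
  have hf1 : ∀ z, ‖z‖ < 1 → deriv f z = powerSum (fun n => ((n : ℂ) + 1) * b n) z :=
    fun z hz => (hbc.hasDerivAt_of_eq_mul hfb hz).deriv
  have hb0 : b 0 = 1 := by
    rw [← h1, hf1 0 (by simp), powerSum_zero]; simp
  have hb1 := hbc.succ_mul
  have hf2 : ∀ z, ‖z‖ < 1 → z * deriv (deriv f) z =
      powerSum (fun n => (n : ℂ) * (((n : ℂ) + 1) * b n)) z := fun z hz => by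
    have hev : deriv f =ᶠ[nhds z] powerSum (fun n => ((n : ℂ) + 1) * b n) := by
      filter_upwards [Metric.isOpen_ball.mem_nhds (mem_unitDisc.2 hz : z ∈ Metric.ball (0 : ℂ) 1)]
        with w hw
      exact hf1 w (mem_unitDisc.1 hw)
    rw [hev.deriv_eq, (hb1.hasDerivAt hz).deriv, hb1.mul_powerSum_deriv hz]
  have hds : ∀ z, ‖z‖ < 1 → dslope f 0 z = powerSum b z := fun z hz => by
    by_cases hz0 : z = 0
    · rw [hz0, dslope_same, h1, powerSum_zero, hb0]
    · rw [dslope_of_ne _ hz0, slope_def_field, h0, hfb z hz]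
      field_simp
      ring
  have c1 := hbc.const_mul (1 - α + 2 * γ : ℂ)
  have c2 := hb1.const_mul (α - 2 * γ : ℂ)
  have c3 := hb1.nat_mul.const_mul (γ : ℂ)
  have hα : (α : ℂ) = μ + ν + γ := by
    rw [← Complex.ofReal_add, ← Complex.ofReal_add]; congr 1; linarith
  have hγ : (γ : ℂ) = μ * ν := by rw [← hprod]; push_cast; ring
  -- The relations `μ + ν = α - γ` and `μν = γ` factor the quadratic `1 + (α - γ)n + γn²`.
  have ecoef : (fun n : ℕ => (1 + n * μ) * (1 + n * ν) * b n) = fun n : ℕ =>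
      (1 - α + 2 * γ) * b n + (α - 2 * γ) * (((n : ℂ) + 1) * b n) +
        γ * ((n : ℂ) * (((n : ℂ) + 1) * b n)) := by
    ext n
    rw [hα, hγ]
    ring
  refine ⟨b, hbc, hb0, hfb, ?_, fun z hz => ?_⟩
  · rw [ecoef]; exact (c1.add c2).add c3
  · rw [ecoef, (c1.add c2).powerSum_add c3 hz, c1.powerSum_add c2 hz,
      hbc.powerSum_const_mul _ hz, hb1.powerSum_const_mul _ hz,
      hb1.nat_mul.powerSum_const_mul _ hz, hds z hz, hf1 z hz, ← hf2 z hz]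
    ring

theorem Vop_eq_mul_powerSum {lam : ℝ → ℝ} {f : ℂ → ℂ} {b : ℕ → ℂ} (hlam : IntegrableOn lam (Ioo 0 1))
    (hb : AbsConvOnDisc b) (hf : ∀ z, ‖z‖ < 1 → f z = z * powerSum b z) {z : ℂ} (hz : ‖z‖ < 1) :
    Vop lam f z = z * powerSum
      (fun n => ((∫ t in Ioo (0 : ℝ) 1, lam t * t ^ n : ℝ) : ℂ) * b n) z := by
  rw [powerSum, (hb.hasSum_integral_ray hlam hz).tsum_eq, Vop,
    intervalIntegral.integral_of_le zero_le_one, integral_Ioc_eq_integral_Ioo,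
    ← integral_const_mul]
  refine setIntegral_congr_fun measurableSet_Ioo fun t ht => ?_
  have hn : ‖(t : ℂ) * z‖ < 1 := by
    rw [norm_mul, Complex.norm_real, Real.norm_of_nonneg ht.1.le]
    exact mul_lt_one_of_nonneg_of_lt_one_left ht.1.le ht.2 hz.le
  have ht0 : (t : ℂ) ≠ 0 := Complex.ofReal_ne_zero.2 ht.1.ne'
  simp only [hf _ hn]
  field_simp

theorem theoremA
    (α γ μ ν ξ β : ℝ) (lam g q : ℝ → ℝ)
    (hα : 0 ≤ α) (hγ : 0 < γ) (hν : 0 ≤ ν)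
    (hsum : μ + ν = α - γ) (hprod : μ * ν = γ)
    (hlam_nonneg : ∀ t ∈ Ioo (0 : ℝ) 1, 0 ≤ lam t)
    (hlam_int : IntegrableOn lam (Icc 0 1))
    (hlam_one : ∫ t in (0 : ℝ)..1, lam t = 1)
    (hPi_int : IntegrableOn (PiFn lam μ ν) (Icc 0 1))
    (hPi_pos : ∀ t ∈ Ioo (0 : ℝ) 1, 0 < PiFn lam μ ν t)
    (hLambda_int : IntegrableOn (LambdaFn lam ν) (Icc 0 1))
    (hLambda_pos : ∀ t ∈ Ioo (0 : ℝ) 1, 0 < LambdaFn lam ν t)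
    (hξ₀ : 0 ≤ ξ) (hξ₁ : ξ ≤ 1) (hμ : 1 ≤ μ)
    (hmono : MonotoneOn (pascuQuotient lam ξ μ ν) (Ioo 0 1))
    (hg : IsSolutionG μ ν g) (hq : IsSolutionQ μ ν q)
    (hβ : β < 1)
    (hβ_eq : β / (1 - β) =
      -∫ t in (0 : ℝ)..1, lam t * ((1 - ξ) * g t + ξ * (2 * q t - 1))) :
    Vop lam '' classW β α γ ⊆ classM ξ := by
  have hν0 : 0 < ν := hν.lt_of_ne fun h => by
    rw [← h, mul_zero] at hprod
    exact hγ.ne hprod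
  have hlam : IntegrableOn lam (Ioo 0 1) := hlam_int.mono_set Ioo_subset_Icc_self
  rintro _ ⟨f, ⟨hfA, φ, hφ⟩, rfl⟩
  obtain ⟨b, hb, hb0, hfb, hk, hkf⟩ := exists_coeff_of_mem_classA hfA hsum hprod
  have hA : AbsConvOnDisc fun n => ((∫ t in Ioo (0 : ℝ) 1, lam t * t ^ n : ℝ) : ℂ) * b n :=
    hb.bounded_mul fun n => by
      rw [Complex.norm_real]
      exact norm_integral_mul_pow_le hlam n
  refine mem_classM_of_powerSum hA (fun z hz => Vop_eq_mul_powerSum hlam hb hfb hz) ?_ ?_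
  · rw [intervalIntegral.integral_of_le zero_le_one, integral_Ioc_eq_integral_Ioo] at hlam_one
    simp [hb0, hlam_one]
  · intro z ε hz hε
    have h := powerSum_dualCoeff_mul_ne_zero (φ := φ) hν0 hlam_int hlam_one hPi_pos hLambda_pos
      hξ₀ hξ₁ hμ hmono hg hq hβ hβ_eq hk (by simp [hb0])
      (fun w hw => by rw [← hkf w hw]; exact hφ w (mem_unitDisc.2 hw)) hz hε
    -- The factors `(1 + nμ)(1 + nν)` from the class `W` cancel the denominators in the multiplier.
    convert h using 2
    ext n
    have hn : (0 : ℝ) ≤ n := n.cast_nonneg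
    have h1 : ((1 : ℂ) + n * μ) ≠ 0 := by
      have : (1 + n * μ : ℝ) ≠ 0 := by positivity
      exact_mod_cast this
    have h2 : ((1 : ℂ) + n * ν) ≠ 0 := by
      have : (1 + n * ν : ℝ) ≠ 0 := by positivity
      exact_mod_cast this
    unfold dualCoeff
    push_cast
    field_simp
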